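/- Call a finite simple graph outerplanar if it has a planar drawing in which all vertices lie on the outer (unbounded) face, let $P_4$ be the path on $4$ vertices, and let the number of induced $P_4$'s in a graph $G$ be the number of vertex subsets $S \subseteq V(G)$ for which $G[S]$ is isomorphic to $P_4$. There is a constant $C$ such that for every $n$, every $n$-vertex outerplanar graph contains at most $\frac{1}{2}n^2 + C\,n\log n$ induced $P_4$'s. Moreover, the leading term is asymptotically attained: there are $n$-vertex outerplanar graphs $G_n$, $n = 0, 1, 2, \dots$, such that the number of induced $P_4$'s in $G_n$ is $(1+o(1))\,\frac{1}{2}n^2$ as $n \to \infty$. -/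

import Mathlib

open Filter Asymptotics

namespace SimpleGraph

/-- A planar drawing of `G` in the Euclidean plane: vertices are distinct points, every edge `uv` is
a simple arc (the image of an injective continuous path) joining the points of `u` and `v`, an arc
passes through no vertex other than the ends of its edge, and two distinct arcs meet only in
vertices (which are then common ends of the two edges). -/
structure PlaneDrawing {V : Type*} (G : SimpleGraph V) where
  /-- The position of a vertex. -/
  point : V → ℝ × ℝ
  /-- The set of points on the curve that represents an edge. -/
  arc : G.edgeSet → Set (ℝ × ℝ)
  point_injective : Function.Injective point
  arc_isSimpleArc : ∀ (u v : V) (h : G.Adj u v),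
    ∃ γ : _root_.Path (point u) (point v), Function.Injective γ ∧ arc ⟨s(u, v), h⟩ = Set.range γ
  mem_of_point_mem_arc : ∀ (e : G.edgeSet) (w : V), point w ∈ arc e → w ∈ (e : Sym2 V)
  arc_inter_arc : ∀ e f : G.edgeSet, e ≠ f → arc e ∩ arc f ⊆ Set.range point

namespace PlaneDrawing

variable {V : Type*} {G : SimpleGraph V}

/-- The set of all points of the plane covered by the drawing. -/
def carrier (D : G.PlaneDrawing) : Set (ℝ × ℝ) :=
  Set.range D.point ∪ ⋃ e, D.arc e

/-- The outer face of the drawing of a finite graph: the points off the drawing whose face (the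
connected component of the complement of the drawing containing the point) is unbounded. -/
def outerFace (D : G.PlaneDrawing) : Set (ℝ × ℝ) :=
  {z | z ∈ D.carrierᶜ ∧ ¬ Bornology.IsBounded (connectedComponentIn D.carrierᶜ z)}

end PlaneDrawing

/-- A graph is outerplanar if it has a planar drawing in which every vertex lies on the outer face.
(Vertices are never in the open outer face itself, so membership in the closure says that the
vertex is on its boundary.) -/
def IsOuterplanar {V : Type*} (G : SimpleGraph V) : Prop :=
  ∃ D : G.PlaneDrawing, ∀ v : V, D.point v ∈ closure D.outerFace

/-- The number of induced copies of `H` in a finite graph `G`: the number of vertex sets of `G` that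
induce a subgraph isomorphic to `H`. -/
noncomputable def inducedCopyCount {V W : Type*} (G : SimpleGraph V) (H : SimpleGraph W) : ℕ :=
  {S : Finset V | Nonempty (G.induce (S : Set V) ≃g H)}.ncard

end SimpleGraph

/-! The upper bound uses only that an outerplanar graph has no `K₂,₃` minor. Such a minor, together with
a point of the outer face joined to its three middle branch sets, would be a planar drawing of `K₃,₃`
(`IsOuterplanar.k23Free`). That `K₃,₃` has no planar drawing is proved by a parity argument: for
disjoint curves `γ` and `δ` on `[0, 1]`, the difference `γ s - δ t` has a continuous logarithm on the
unit square, whose increments along the four sides are related (`logVariation_square`). Over the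
eighteen pairs of independent edges of `K₃,₃` the resulting equations between integers are
inconsistent modulo `2` (`not_exists_almost_embedding_K33`).

Let `G` have no `K₂,₃` minor. Every vertex set `W` has a separator `S` of at most five vertices that
leaves two sides `A`, `B` with at most `2 / 3` of the vertices each
(`K23Free.exists_balanced_separation`). An induced path on four vertices that meets both sides
determines a pair `(a, b)` in `A × B` together with a connection of `a` and `b` through `S`, and
`crossWeight` counts these connections. All but boundedly many vertices of each side are connected to
`S` essentially through one vertex only. A pair of such vertices has at most one connection, unless
`a` is a neighbour of some `s` in `S` and there are two induced paths `s - c - b`, or conversely. To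
compensate for these pairs, give `a` the sign `1` if it is a neighbour of `s` and the sign `-1` if it
is the end of two induced paths `s - c - a`. Pairs of neighbours of the same `s` have no connection,
so that the number of connections is at most `1 - ∑ s, sign s a * sign s b`
(`K23Free.crossWeight_le_sign`). Since `G` has no `K₂,₃` minor, vertices with sign `-1` are at most as
numerous as those with sign `1`, up to boundedly many (`K23Free.sum_sign_ge`), and the sum of the
products over all pairs factors. Hence at most `|A| * |B| + O(|W|)` induced paths cross
(`K23Free.sum_crossWeight_le`). In the recursion along separations the products add up to `n ^ 2 / 2`,
since each pair of vertices is separated about once, and the linear errors to `O(n * log n)`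
(`K23Free.p4Count_le`).

For the lower bound, take the fan with hub `0` over the path of the odd numbers and attach a triangle
with an even vertex to each edge of the path. Its edges do not cross in the order of the vertices, so
it has an outerplanar drawing with the vertices on a parabola (`isOuterplanar_of_noncrossing`). Each of
the about `n / 2` even vertices starts an induced path that runs through one of its two odd neighbours
and the hub to any of about `n / 2` other odd vertices, which gives `n ^ 2 / 2 - O(n)` induced paths
(`le_p4Count_fanGraph`).
-/

/-! ### Logarithms along paths and the non-planarity of `K₃,₃` -/

section LogVariation

/-- On a simply connected space, a continuous function without zeros has a continuous logarithm. -/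
theorem exists_continuous_log {A : Type*} [TopologicalSpace A] [SimplyConnectedSpace A]
    [LocallyPathConnectedSpace A] {f : A → ℂ} (hf : Continuous f) (h0 : ∀ a, f a ≠ 0) :
    ∃ g : A → ℂ, Continuous g ∧ ∀ a, Complex.exp (g a) = f a := by
  obtain ⟨a₀⟩ : Nonempty A := inferInstance
  obtain ⟨g, ⟨-, hg⟩, -⟩ := Complex.isCoveringMap_exp.existsUnique_continuousMap_lifts
    (⟨fun a => ⟨f a, h0 a⟩, by fun_prop⟩ : C(A, {z : ℂ // z ≠ 0})) a₀ (Complex.log (f a₀))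
    (Subtype.ext (Complex.exp_log (h0 a₀)))
  exact ⟨g, g.continuous, fun a => congrArg Subtype.val (congrFun hg a)⟩

/-- Two continuous logarithms of functions that differ by a constant factor have the same
increment. -/
theorem log_increment_unique {l l' : ℝ → ℂ} (hl : Continuous l) (hl' : Continuous l') {c : ℂ}
    (h : ∀ t, Complex.exp (l t) = c * Complex.exp (l' t)) : l 1 - l 0 = l' 1 - l' 0 := by
  have key : l = fun t => l' t + (l 0 - l' 0) := by
    refine Complex.isCoveringMap_exp.eq_of_comp_eq hl (by fun_prop) ?_ 0 (by ring)
    funext t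
    apply Subtype.ext
    have hc : c = Complex.exp (l 0 - l' 0) := by
      rw [Complex.exp_sub, h 0, mul_div_assoc, div_self (Complex.exp_ne_zero _), mul_one]
    simp only [Function.comp]
    rw [h t, hc, Complex.exp_add, mul_comm]
  have h1 : l 1 = l' 1 + (l 0 - l' 0) := congrFun key 1
  rw [h1]
  ring

open Classical in
/-- The increment over `[0, 1]` of a continuous logarithm of `γ - y`, for a curve `γ` that avoids
the point `y` (and `0` if there is no such logarithm). -/
noncomputable def logVariation (γ : ℝ → ℂ) (y : ℂ) : ℂ :=
  if h : ∃ l : ℝ → ℂ, Continuous l ∧ ∀ t, Complex.exp (l t) = γ t - y then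
    h.choose 1 - h.choose 0 else 0

theorem logVariation_eq {γ : ℝ → ℂ} {y c : ℂ} (hγ : Continuous γ) (hy : ∀ t, γ t ≠ y) {l : ℝ → ℂ}
    (hl : Continuous l) (h : ∀ t, Complex.exp (l t) = c * (γ t - y)) :
    l 1 - l 0 = logVariation γ y := by
  have hex : ∃ l : ℝ → ℂ, Continuous l ∧ ∀ t, Complex.exp (l t) = γ t - y :=
    exists_continuous_log (by fun_prop) fun t => sub_ne_zero.2 (hy t)
  rw [logVariation, dif_pos hex]
  exact log_increment_unique hl hex.choose_spec.1 fun t => by rw [h, hex.choose_spec.2]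

theorem exp_logVariation {γ : ℝ → ℂ} {y : ℂ} (hγ : Continuous γ) (hy : ∀ t, γ t ≠ y) :
    Complex.exp (logVariation γ y) = (γ 1 - y) / (γ 0 - y) := by
  obtain ⟨l, hl, h⟩ := exists_continuous_log (f := fun t => γ t - y) (by fun_prop)
    fun t => sub_ne_zero.2 (hy t)
  rw [← logVariation_eq hγ hy hl (c := 1) (by simpa using h), Complex.exp_sub, h, h]

/-- For disjoint curves `γ` and `δ`, the logarithm of `γ s - δ t` has total increment `0` around
the boundary of the unit square. -/
theorem logVariation_square {γ δ : ℝ → ℂ} (hγ : Continuous γ) (hδ : Continuous δ)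
    (h : ∀ s t, γ s ≠ δ t) :
    logVariation δ (γ 0) + logVariation γ (δ 1) = logVariation γ (δ 0) + logVariation δ (γ 1) := by
  obtain ⟨g, hg, hexp⟩ := exists_continuous_log (f := fun z : ℝ × ℝ => γ z.1 - δ z.2)
    (by fun_prop) fun z => sub_ne_zero.2 (h _ _)
  rw [← logVariation_eq hδ (fun t => (h 0 t).symm) (l := fun t => g (0, t)) (c := -1)
      (by fun_prop) (fun t => by rw [hexp]; ring),
    ← logVariation_eq hδ (fun t => (h 1 t).symm) (l := fun t => g (1, t)) (c := -1)
      (by fun_prop) (fun t => by rw [hexp]; ring),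
    ← logVariation_eq hγ (fun t => h t 0) (l := fun t => g (t, 0)) (c := 1)
      (by fun_prop) (fun t => by rw [hexp]; ring),
    ← logVariation_eq hγ (fun t => h t 1) (l := fun t => g (t, 1)) (c := 1)
      (by fun_prop) (fun t => by rw [hexp]; ring)]
  ring

theorem exists_int_logVariation {γ : ℝ → ℂ} {y a b : ℂ} (hγ : Continuous γ) (hy : ∀ t, γ t ≠ y)
    (ha : Complex.exp a = γ 0 - y) (hb : Complex.exp b = γ 1 - y) :
    ∃ m : ℤ, logVariation γ y = b - a + m * (2 * Real.pi * Complex.I) := by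
  have h : Complex.exp (logVariation γ y - (b - a)) = 1 := by
    rw [Complex.exp_sub, Complex.exp_sub, ha, hb, exp_logVariation hγ hy, div_self]
    exact div_ne_zero (sub_ne_zero.2 (hy 1)) (sub_ne_zero.2 (hy 0))
  obtain ⟨m, hm⟩ := Complex.exp_eq_one_iff.1 h
  exact ⟨m, by rw [← hm]; ring⟩

/-- Non-planarity of `K₃,₃`, for drawings in which curves of adjacent edges may meet: there are no
curves from three points `X a` to three points `Z b` such that the curves of independent edges are
disjoint. For each pair of independent edges `logVariation_square` is an equation between the
integers that compare the increments of logarithms with fixed logarithms of the differences of the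
six points; summed modulo `2` these equations are contradictory. -/
theorem not_exists_almost_embedding_K33 (X Z : Fin 3 → ℂ) (e : Fin 3 → Fin 3 → ℝ → ℂ)
    (hcont : ∀ a b, Continuous (e a b)) (h0 : ∀ a b, e a b 0 = X a) (h1 : ∀ a b, e a b 1 = Z b)
    (hdisj : ∀ a b c d, a ≠ c → b ≠ d → ∀ s t, e a b s ≠ e c d t) : False := by
  -- `other a` is an index different from `a`, used to see the end points of edges.
  obtain ⟨other, hother⟩ : ∃ o : Fin 3 → Fin 3, ∀ a, o a ≠ a := ⟨fun a => a + 1, by decide⟩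
  have hXe : ∀ a c d, a ≠ c → ∀ t, e c d t ≠ X a := fun a c d hac t => by
    rw [← h0 a (other d)]
    exact (hdisj a (other d) c d hac (hother d) 0 t).symm
  have hZe : ∀ d a b, d ≠ b → ∀ t, e a b t ≠ Z d := fun d a b hdb t => by
    rw [← h1 (other a) d]
    exact (hdisj (other a) d a b (hother a) hdb 1 t).symm
  have hX : ∀ a c, a ≠ c → X c ≠ X a := fun a c h => by
    simpa [h0] using hXe a c 0 h 0
  have hZ : ∀ b d, b ≠ d → Z d ≠ Z b := fun b d h => by
    simpa [h1] using hZe b 0 d h 1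
  have hXZ : ∀ a b, Z b ≠ X a := fun a b => by
    have := hXe a (other a) b (hother a).symm 1
    rwa [h1] at this
  -- Logarithms of the differences, with `log (x - y) = log (y - x) + π i` for `x` before `y`.
  let lX : Fin 3 → Fin 3 → ℂ := fun a c =>
    if a < c then Complex.log (X c - X a) else Complex.log (X a - X c) + Real.pi * Complex.I
  let lZ : Fin 3 → Fin 3 → ℂ := fun a c =>
    if a < c then Complex.log (Z c - Z a) else Complex.log (Z a - Z c) + Real.pi * Complex.I
  let μ : Fin 3 → Fin 3 → ℂ := fun a b => Complex.log (Z b - X a)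
  have elX : ∀ a c, a ≠ c → Complex.exp (lX a c) = X c - X a := by
    intro a c hac
    simp only [lX]
    split_ifs
    · exact Complex.exp_log (sub_ne_zero.2 (hX a c hac))
    · rw [Complex.exp_add, Complex.exp_log (sub_ne_zero.2 (hX c a hac.symm)), Complex.exp_pi_mul_I]
      ring
  have elZ : ∀ a c, a ≠ c → Complex.exp (lZ a c) = Z c - Z a := by
    intro a c hac
    simp only [lZ]
    split_ifs
    · exact Complex.exp_log (sub_ne_zero.2 (hZ a c hac))
    · rw [Complex.exp_add, Complex.exp_log (sub_ne_zero.2 (hZ c a hac.symm)), Complex.exp_pi_mul_I]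
      ring
  have eμ : ∀ a b, Complex.exp (μ a b) = Z b - X a := fun a b =>
    Complex.exp_log (sub_ne_zero.2 (hXZ a b))
  have eμ' : ∀ a b, Complex.exp (μ a b + Real.pi * Complex.I) = X a - Z b := fun a b => by
    rw [Complex.exp_add, eμ, Complex.exp_pi_mul_I]
    ring
  have hm : ∀ a c d, ∃ m : ℤ, a ≠ c → logVariation (e c d) (X a) =
      μ a d - lX a c + m * (2 * Real.pi * Complex.I) := fun a c d => by
    by_cases hac : a = c
    · exact ⟨0, fun h => (h hac).elim⟩
    · obtain ⟨m, hm⟩ := exists_int_logVariation (hcont c d) (hXe a c d hac)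
        (a := lX a c) (b := μ a d) (by rw [elX a c hac, h0]) (by rw [eμ, h1])
      exact ⟨m, fun _ => hm⟩
  have hn : ∀ d a b, ∃ m : ℤ, d ≠ b → logVariation (e a b) (Z d) =
      lZ d b - (μ a d + Real.pi * Complex.I) + m * (2 * Real.pi * Complex.I) := fun d a b => by
    by_cases hdb : d = b
    · exact ⟨0, fun h => (h hdb).elim⟩
    · obtain ⟨m, hm⟩ := exists_int_logVariation (hcont a b) (hZe d a b hdb)
        (a := μ a d + Real.pi * Complex.I) (b := lZ d b) (by rw [eμ', h0]) (by rw [elZ d b hdb, h1])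
      exact ⟨m, fun _ => hm⟩
  choose m hm using hm
  choose n hn using hn
  have hπ : (2 * Real.pi * Complex.I : ℂ) ≠ 0 := by simp [Real.pi_ne_zero]
  have key : ∀ a b c d, a < c → b ≠ d →
      m a c d + n d a b - m c a b - n b c d + (if b < d then 1 else 0) = 0 := by
    intro a b c d hac hbd
    have hsq := logVariation_square (hcont a b) (hcont c d) (hdisj a b c d hac.ne hbd)
    rw [h0, h0, h1, h1, hm a c d hac.ne, hn d a b hbd.symm, hm c a b hac.ne', hn b c d hbd] at hsq
    have hlX : lX c a = lX a c + Real.pi * Complex.I := by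
      simp only [lX, if_pos hac, if_neg hac.not_gt]
    have hlZ : lZ d b - lZ b d =
        (if b < d then (1 : ℤ) else 0) * (2 * Real.pi * Complex.I) - Real.pi * Complex.I := by
      rcases lt_or_gt_of_ne hbd with h | h
      · simp only [lZ, if_pos h, if_neg h.not_gt]
        push_cast
        ring
      · simp only [lZ, if_pos h, if_neg h.not_gt]
        push_cast
        ring
    rw [hlX] at hsq
    have : ((m a c d + n d a b - m c a b - n b c d + (if b < d then 1 else 0) : ℤ) : ℂ)
        * (2 * Real.pi * Complex.I) = 0 := by
      push_cast at hlZ ⊢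
      linear_combination hsq - hlZ
    exact_mod_cast (mul_eq_zero.1 this).resolve_right hπ
  have sum_key : ∀ a c, a < c →
      (m a c 1 + n 1 a 0 - m c a 0 - n 0 c 1 = -1 ∧ m a c 2 + n 2 a 0 - m c a 0 - n 0 c 2 = -1 ∧
      m a c 2 + n 2 a 1 - m c a 1 - n 1 c 2 = -1) ∧
      (m a c 0 + n 0 a 1 - m c a 1 - n 1 c 0 = 0 ∧ m a c 0 + n 0 a 2 - m c a 2 - n 2 c 0 = 0 ∧
      m a c 1 + n 1 a 2 - m c a 2 - n 2 c 1 = 0) := by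
    intro a c hac
    have k01 := key a 0 c 1 hac (by decide)
    have k02 := key a 0 c 2 hac (by decide)
    have k12 := key a 1 c 2 hac (by decide)
    have k10 := key a 1 c 0 hac (by decide)
    have k20 := key a 2 c 0 hac (by decide)
    have k21 := key a 2 c 1 hac (by decide)
    rw [if_pos (by decide)] at k01 k02 k12
    rw [if_neg (by decide)] at k10 k20 k21
    omega
  -- Over all eighteen pairs of independent edges every unknown integer occurs twice, and the
  -- constants have the odd sum `-9`.
  have s01 := sum_key 0 1 (by decide)
  have s02 := sum_key 0 2 (by decide)
  have s12 := sum_key 1 2 (by decide)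
  omega

end LogVariation

/-! ### Connected vertex sets and `K₂,₃` minors -/

namespace SimpleGraph

section Connectivity

variable {V : Type*} {G : SimpleGraph V} {X Y Z P K : Finset V}

/-- `Y` is a part of `X` that no edge of `G[X]` leaves, that is, a union of components of `G[X]`. -/
def ClosedIn (G : SimpleGraph V) (Y X : Finset V) : Prop :=
  Y ⊆ X ∧ ∀ y ∈ Y, ∀ x ∈ X, G.Adj y x → x ∈ Y

/-- The finite set `X` of vertices is nonempty and induces a connected subgraph, expressed by the
absence of proper unions of components. -/
def ConnOn (G : SimpleGraph V) (X : Finset V) : Prop :=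
  X.Nonempty ∧ ∀ Y, G.ClosedIn Y X → Y.Nonempty → Y = X

/-- Some edge joins `X` and `Y`. -/
def Touches (G : SimpleGraph V) (X Y : Finset V) : Prop :=
  ∃ x ∈ X, ∃ y ∈ Y, G.Adj x y

/-- `G` has no `K₂,₃` minor: there are no five pairwise disjoint connected vertex sets such that
each of the first two touches each of the other three. -/
def K23Free (G : SimpleGraph V) : Prop :=
  ∀ (P Q : Finset V) (Z : Fin 3 → Finset V), G.ConnOn P → G.ConnOn Q → (∀ i, G.ConnOn (Z i)) →
    Disjoint P Q → (∀ i, Disjoint P (Z i)) → (∀ i, Disjoint Q (Z i)) →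
    (∀ i j, i ≠ j → Disjoint (Z i) (Z j)) →
    (∀ i, G.Touches P (Z i)) → (∀ i, G.Touches Q (Z i)) → False

theorem Touches.symm (h : G.Touches X Y) : G.Touches Y X := by
  obtain ⟨x, hx, y, hy, hxy⟩ := h
  exact ⟨y, hy, x, hx, hxy.symm⟩

theorem ConnOn.singleton (v : V) : G.ConnOn {v} := by
  refine ⟨by simp, fun Y hY hne => ?_⟩
  exact (Finset.subset_singleton_iff.1 hY.1).resolve_left hne.ne_empty

/-- A connected subset of `X` that meets a union `K` of components of `G[X]` lies in `K`. -/
theorem ConnOn.subset_of_closedIn [DecidableEq V] (hY : G.ConnOn Y) (hYX : Y ⊆ X)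
    (hK : G.ClosedIn K X) (hne : (Y ∩ K).Nonempty) : Y ⊆ K := by
  have h : Y ∩ K = Y := by
    refine hY.2 _ ⟨Finset.inter_subset_left, fun y hy x hx hyx => ?_⟩ hne
    rw [Finset.mem_inter] at hy ⊢
    exact ⟨hx, hK.2 y hy.2 x (hYX hx) hyx⟩
  exact Finset.inter_eq_left.1 h

theorem ConnOn.union [DecidableEq V] (hX : G.ConnOn X) (hY : G.ConnOn Y) (h : G.Touches X Y) :
    G.ConnOn (X ∪ Y) := by
  obtain ⟨x, hx, y, hy, hxy⟩ := h
  refine ⟨hX.1.mono Finset.subset_union_left, fun A hA hne => ?_⟩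
  have hxA : x ∈ A ∨ y ∈ A → A = X ∪ Y := by
    intro h
    have hx' : x ∈ A := h.elim id fun h => hA.2 y h x (Finset.mem_union_left _ hx) hxy.symm
    have hy' : y ∈ A := hA.2 x hx' y (Finset.mem_union_right _ hy) hxy
    refine hA.1.antisymm (Finset.union_subset ?_ ?_)
    · exact hX.subset_of_closedIn Finset.subset_union_left hA ⟨x, Finset.mem_inter.2 ⟨hx, hx'⟩⟩
    · exact hY.subset_of_closedIn Finset.subset_union_right hA ⟨y, Finset.mem_inter.2 ⟨hy, hy'⟩⟩
  obtain ⟨a, ha⟩ := hne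
  rcases Finset.mem_union.1 (hA.1 ha) with h | h
  · exact hxA (Or.inl (hX.subset_of_closedIn Finset.subset_union_left hA
      ⟨a, Finset.mem_inter.2 ⟨h, ha⟩⟩ hx))
  · exact hxA (Or.inr (hY.subset_of_closedIn Finset.subset_union_right hA
      ⟨a, Finset.mem_inter.2 ⟨h, ha⟩⟩ hy))

theorem ConnOn.pair [DecidableEq V] {a b : V} (h : G.Adj a b) : G.ConnOn {a, b} :=
  (ConnOn.singleton a).union (ConnOn.singleton b) ⟨a, by simp, b, by simp, h⟩

end Connectivity

end SimpleGraph

/-! ### Outerplanar graphs have no `K₂,₃` minor -/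

/-- The complement of a ball in the plane is connected. -/
theorem isPreconnected_norm_gt (r : ℝ) : IsPreconnected {z : ℝ × ℝ | r < ‖z‖} := by
  rcases lt_or_ge r 0 with hr | hr
  · rw [show {z : ℝ × ℝ | r < ‖z‖} = Set.univ from
      Set.eq_univ_of_forall fun z => hr.trans_le (norm_nonneg z)]
    exact isPreconnected_univ
  have hs : IsPreconnected (Metric.sphere (0 : ℝ × ℝ) 1) :=
    isPreconnected_sphere (by simp; norm_num) 0 1
  have himg : {z : ℝ × ℝ | r < ‖z‖} =
      (fun p : ℝ × (ℝ × ℝ) => p.1 • p.2) '' (Set.Ioi r ×ˢ Metric.sphere (0 : ℝ × ℝ) 1) := by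
    ext z
    constructor
    · intro hz
      have hz0 : 0 < ‖z‖ := hr.trans_lt hz
      refine ⟨(‖z‖, ‖z‖⁻¹ • z), ⟨hz, ?_⟩, ?_⟩
      · simp [norm_smul, hz0.ne']
      · simp [smul_smul, hz0.ne']
    · rintro ⟨⟨t, w⟩, ⟨ht, hw⟩, rfl⟩
      have ht' : r < t := ht
      have hw' : ‖w‖ = 1 := by simpa using hw
      simp only [Set.mem_ofPred_eq, norm_smul, hw', Real.norm_eq_abs, mul_one]
      exact ht'.trans_le (le_abs_self t)
  rw [himg]
  exact (isPreconnected_Ioi.prod hs).image _ (by fun_prop)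

/-- Non-planarity of `K₃,₃`, for regions that contain the curves of the edges. -/
theorem not_joinedIn_K33 (X Z : Fin 3 → ℝ × ℝ) (A : Fin 3 → Fin 3 → Set (ℝ × ℝ))
    (hA : ∀ a b, JoinedIn (A a b) (X a) (Z b))
    (hdisj : ∀ a b c d, a < c → b ≠ d → Disjoint (A a b) (A c d)) : False := by
  have hdisj' : ∀ a b c d, a ≠ c → b ≠ d → Disjoint (A a b) (A c d) := fun a b c d hac hbd => by
    rcases lt_or_gt_of_ne hac with h | h
    · exact hdisj a b c d h hbd
    · exact (hdisj c d a b h hbd.symm).symm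
  let φ := Complex.equivRealProdCLM.symm
  refine not_exists_almost_embedding_K33 (fun a => φ (X a)) (fun b => φ (Z b))
    (fun a b t => φ ((hA a b).somePath.extend t)) (fun a b => ?_) (fun a b => by simp)
    (fun a b => by simp) fun a b c d hac hbd s t h => ?_
  · exact φ.continuous.comp (Path.continuous_extend _)
  · have hmem : ∀ a b s, (hA a b).somePath.extend s ∈ A a b := fun a b s =>
      (hA a b).somePath_mem _
    exact Set.disjoint_left.1 (hdisj' a b c d hac hbd) (hmem a b s)
      (φ.injective h ▸ hmem c d t)

namespace SimpleGraph

namespace PlaneDrawing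

variable {V : Type*} {G : SimpleGraph V} (D : G.PlaneDrawing)

/-- The part of a drawing that represents the subgraph induced by `X`. -/
def inducedCarrier (X : Finset V) : Set (ℝ × ℝ) :=
  D.point '' X ∪ ⋃ (e : G.edgeSet) (_ : ∀ v ∈ (e : Sym2 V), v ∈ X), D.arc e

theorem inducedCarrier_subset (X : Finset V) : D.inducedCarrier X ⊆ D.carrier := by
  apply Set.union_subset_union (Set.image_subset_range _ _)
  exact Set.iUnion_mono fun e => Set.iUnion_subset fun _ => subset_rfl

theorem isCompact_arc (e : G.edgeSet) : IsCompact (D.arc e) := by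
  obtain ⟨⟨u, v⟩, h⟩ := e
  obtain ⟨γ, -, hγ⟩ := D.arc_isSimpleArc u v h
  rw [show (⟨Quot.mk _ (u, v), h⟩ : G.edgeSet) = ⟨s(u, v), h⟩ from rfl, hγ]
  exact isCompact_range γ.continuous

theorem isCompact_inducedCarrier [Finite V] (X : Finset V) : IsCompact (D.inducedCarrier X) := by
  refine (X.finite_toSet.image _).isCompact.union ?_
  exact isCompact_iUnion fun e => isCompact_iUnion fun _ => D.isCompact_arc e

theorem isCompact_carrier [Finite V] : IsCompact D.carrier :=
  (Set.finite_range _).isCompact.union (isCompact_iUnion D.isCompact_arc)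

theorem mem_of_point_mem_inducedCarrier {X : Finset V} {w : V}
    (h : D.point w ∈ D.inducedCarrier X) : w ∈ X := by
  rcases h with ⟨v, hv, hvw⟩ | h
  · exact D.point_injective hvw ▸ hv
  · simp only [Set.mem_iUnion] at h
    obtain ⟨e, he, hw⟩ := h
    exact he w (D.mem_of_point_mem_arc e w hw)

theorem disjoint_inducedCarrier {X Y : Finset V} (h : Disjoint X Y) :
    Disjoint (D.inducedCarrier X) (D.inducedCarrier Y) := by
  rw [Set.disjoint_left]
  intro z hX hY
  -- A common point cannot be a vertex, so it lies on two arcs, which meet in vertices only.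
  have hv : z ∉ Set.range D.point := by
    rintro ⟨w, rfl⟩
    exact Finset.disjoint_left.1 h (D.mem_of_point_mem_inducedCarrier hX)
      (D.mem_of_point_mem_inducedCarrier hY)
  rcases hX with hX | hX
  · exact hv (Set.image_subset_range _ _ hX)
  rcases hY with hY | hY
  · exact hv (Set.image_subset_range _ _ hY)
  simp only [Set.mem_iUnion] at hX hY
  obtain ⟨e, he, hze⟩ := hX
  obtain ⟨f, hf, hzf⟩ := hY
  refine hv (D.arc_inter_arc e f ?_ ⟨hze, hzf⟩)
  rintro rfl
  obtain ⟨⟨u, v⟩, huv⟩ := e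
  exact Finset.disjoint_left.1 h (he u (Sym2.mem_mk_left u v)) (hf u (Sym2.mem_mk_left u v))

theorem joinedIn_inducedCarrier {X : Finset V} (hX : G.ConnOn X) {u v : V} (hu : u ∈ X)
    (hv : v ∈ X) : JoinedIn (D.inducedCarrier X) (D.point u) (D.point v) := by
  classical
  have hpt : ∀ w ∈ X, D.point w ∈ D.inducedCarrier X := fun w hw =>
    Or.inl (Set.mem_image_of_mem _ hw)
  have h : X.filter (fun w => JoinedIn (D.inducedCarrier X) (D.point u) (D.point w)) = X := by
    refine hX.2 _ ⟨Finset.filter_subset _ _, fun y hy x hx hyx => ?_⟩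
      ⟨u, Finset.mem_filter.2 ⟨hu, JoinedIn.refl (hpt u hu)⟩⟩
    rw [Finset.mem_filter] at hy ⊢
    refine ⟨hx, hy.2.trans ?_⟩
    obtain ⟨γ, -, hγ⟩ := D.arc_isSimpleArc y x hyx
    refine ⟨γ, fun t => Or.inr ?_⟩
    simp only [Set.mem_iUnion]
    refine ⟨⟨s(y, x), hyx⟩, fun w hw => ?_, hγ ▸ Set.mem_range_self t⟩
    rcases Sym2.mem_iff.1 hw with rfl | rfl
    · exact hy.1
    · exact hx
  rw [← h] at hv
  exact (Finset.mem_filter.1 hv).2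

/-- The outer face of a finite drawing is open and connected: it is the component that contains
the complement of a large ball. -/
theorem outerFace_isOpen_isConnected [Finite V] :
    IsOpen D.outerFace ∧ IsConnected D.outerFace := by
  obtain ⟨r, hr⟩ := D.isCompact_carrier.isBounded.exists_norm_le
  have hE : {z : ℝ × ℝ | r < ‖z‖} ⊆ D.carrierᶜ := fun z hz hzD => absurd (hr z hzD) (not_le.2 hz)
  obtain ⟨w, hw⟩ := NormedSpace.exists_lt_norm ℝ (ℝ × ℝ) r
  have hw' : w ∈ {z : ℝ × ℝ | r < ‖z‖} := hw
  have hEw : {z : ℝ × ℝ | r < ‖z‖} ⊆ connectedComponentIn D.carrierᶜ w :=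
    (isPreconnected_norm_gt r).subset_connectedComponentIn hw' hE
  have hunb : ¬ Bornology.IsBounded (connectedComponentIn D.carrierᶜ w) := fun hb => by
    obtain ⟨s, hs⟩ := hb.exists_norm_le
    obtain ⟨x, hx⟩ := NormedSpace.exists_lt_norm ℝ (ℝ × ℝ) (max r s)
    exact absurd (hs x (hEw ((le_max_left _ _).trans_lt hx)))
      (not_le.2 ((le_max_right _ _).trans_lt hx))
  have heq : D.outerFace = connectedComponentIn D.carrierᶜ w := by
    ext z
    constructor
    · rintro ⟨hz, hzb⟩
      obtain ⟨x, hx, hxr⟩ : ∃ x ∈ connectedComponentIn D.carrierᶜ z, r < ‖x‖ := by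
        by_contra! hcon
        exact hzb (isBounded_iff_forall_norm_le.2 ⟨r, hcon⟩)
      rw [connectedComponentIn_eq (hEw hxr), ← connectedComponentIn_eq hx]
      exact mem_connectedComponentIn hz
    · intro hz
      refine ⟨connectedComponentIn_subset _ _ hz, ?_⟩
      rwa [← connectedComponentIn_eq hz]
  rw [heq]
  exact ⟨D.isCompact_carrier.isClosed.isOpen_compl.connectedComponentIn,
    isConnected_connectedComponentIn_iff.2 (hE hw)⟩

end PlaneDrawing

/-- A `K₂,₃` minor in an outerplanar graph, together with a point of the outer face joined to the
three middle branch sets, would be a planar drawing of `K₃,₃`. -/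
theorem IsOuterplanar.k23Free {V : Type*} [Finite V] {G : SimpleGraph V} (hG : G.IsOuterplanar) :
    G.K23Free := by
  classical
  obtain ⟨D, hD⟩ := hG
  intro P Q Z hP hQ hZ hPQ hPZ hQZ hZZ hPt hQt
  obtain ⟨hopen, hconn⟩ := D.outerFace_isOpen_isConnected
  have hcarrier : Disjoint D.outerFace D.carrier :=
    Set.disjoint_left.2 fun z hz => hz.1
  obtain ⟨u, hu⟩ := hconn.nonempty
  obtain ⟨p, hp⟩ := hP.1
  obtain ⟨q, hq⟩ := hQ.1
  choose z hz using fun i => (hZ i).1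
  -- A ball around a middle vertex that avoids the other branch sets.
  let K : Fin 3 → Set (ℝ × ℝ) := fun i =>
    ⋃ (j : Fin 3) (_ : j ≠ i), D.inducedCarrier (P ∪ Z j) ∪ D.inducedCarrier (Q ∪ Z j)
  have hK : ∀ i, ∃ ε > 0, Disjoint (Metric.ball (D.point (z i)) ε) (K i) := fun i => by
    have hKc : IsClosed (K i) := (isCompact_iUnion fun j => isCompact_iUnion fun _ =>
      (D.isCompact_inducedCarrier _).union (D.isCompact_inducedCarrier _)).isClosed
    have hzK : D.point (z i) ∈ (K i)ᶜ := by
      intro h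
      simp only [K, Set.mem_iUnion] at h
      obtain ⟨j, hj, h | h⟩ := h
      · rcases Finset.mem_union.1 (D.mem_of_point_mem_inducedCarrier h) with h | h
        · exact Finset.disjoint_left.1 (hPZ i) h (hz i)
        · exact Finset.disjoint_left.1 (hZZ j i hj) h (hz i)
      · rcases Finset.mem_union.1 (D.mem_of_point_mem_inducedCarrier h) with h | h
        · exact Finset.disjoint_left.1 (hQZ i) h (hz i)
        · exact Finset.disjoint_left.1 (hZZ j i hj) h (hz i)
    obtain ⟨ε, hε, h⟩ := Metric.isOpen_iff.1 hKc.isOpen_compl _ hzK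
    exact ⟨ε, hε, Set.disjoint_left.2 fun x hx => h hx⟩
  choose ε hε hball using hK
  have hface : ∀ i, JoinedIn (D.outerFace ∪ Metric.ball (D.point (z i)) (ε i)) u
      (D.point (z i)) := fun i => by
    have hne : (D.outerFace ∩ Metric.ball (D.point (z i)) (ε i)).Nonempty := by
      rw [Set.inter_comm]
      exact mem_closure_iff.1 (hD (z i)) _ Metric.isOpen_ball (Metric.mem_ball_self (hε i))
    have hc : IsConnected (D.outerFace ∪ Metric.ball (D.point (z i)) (ε i)) :=
      hconn.union hne ((convex_ball _ _).isConnected ⟨_, Metric.mem_ball_self (hε i)⟩)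
    exact ((hopen.union Metric.isOpen_ball).isConnected_iff_isPathConnected.1 hc).joinedIn _
      (Or.inl hu) _ (Or.inr (Metric.mem_ball_self (hε i)))
  have hPd : ∀ i j, i ≠ j → Disjoint (P ∪ Z i) (Q ∪ Z j) := fun i j hij => by
    rw [Finset.disjoint_union_left, Finset.disjoint_union_right, Finset.disjoint_union_right]
    exact ⟨⟨hPQ, hPZ j⟩, (hQZ i).symm, hZZ i j hij⟩
  have hsub : ∀ i j, i ≠ j → Disjoint (D.inducedCarrier (P ∪ Z i))
      (D.outerFace ∪ Metric.ball (D.point (z j)) (ε j)) ∧ Disjoint (D.inducedCarrier (Q ∪ Z i))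
      (D.outerFace ∪ Metric.ball (D.point (z j)) (ε j)) := fun i j hij => by
    have hmem : D.inducedCarrier (P ∪ Z i) ∪ D.inducedCarrier (Q ∪ Z i) ⊆ K j :=
      Set.subset_iUnion₂_of_subset i hij subset_rfl
    constructor
    · exact Set.disjoint_union_right.2 ⟨(hcarrier.mono_right (D.inducedCarrier_subset _)).symm,
        ((hball j).mono_right (Set.subset_union_left.trans hmem)).symm⟩
    · exact Set.disjoint_union_right.2 ⟨(hcarrier.mono_right (D.inducedCarrier_subset _)).symm,
        ((hball j).mono_right (Set.subset_union_right.trans hmem)).symm⟩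
  refine not_joinedIn_K33 ![D.point p, D.point q, u] (fun i => D.point (z i))
    (fun a i => ![D.inducedCarrier (P ∪ Z i), D.inducedCarrier (Q ∪ Z i),
      D.outerFace ∪ Metric.ball (D.point (z i)) (ε i)] a) (fun a i => ?_)
    fun a b c d hac hbd => ?_
  · fin_cases a
    · exact D.joinedIn_inducedCarrier (hP.union (hZ i) (hPt i)) (Finset.mem_union_left _ hp)
        (Finset.mem_union_right _ (hz i))
    · exact D.joinedIn_inducedCarrier (hQ.union (hZ i) (hQt i)) (Finset.mem_union_left _ hq)
        (Finset.mem_union_right _ (hz i))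
    · exact hface i
  · fin_cases a <;> fin_cases c <;> first | exact absurd hac (by decide) | skip
    · exact D.disjoint_inducedCarrier (hPd b d hbd)
    · exact (hsub b d hbd).1
    · exact (hsub b d hbd).2

end SimpleGraph

/-! ### Balanced separators of bounded size -/

namespace SimpleGraph

section Separator

variable {V : Type*} {G : SimpleGraph V} {X Y Z P K H W : Finset V}

theorem ClosedIn.trans (h : G.ClosedIn X Y) (h' : G.ClosedIn Y Z) : G.ClosedIn X Z :=
  ⟨h.1.trans h'.1, fun x hx z hz hxz => h.2 x hx z (h'.2 x (h.1 hx) z hz hxz) hxz⟩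

theorem K23Free.false (hG : G.K23Free) {P Q Z₁ Z₂ Z₃ : Finset V} (hP : G.ConnOn P)
    (hQ : G.ConnOn Q) (h₁ : G.ConnOn Z₁) (h₂ : G.ConnOn Z₂) (h₃ : G.ConnOn Z₃)
    (hPQ : Disjoint P Q) (hP₁ : Disjoint P Z₁) (hP₂ : Disjoint P Z₂) (hP₃ : Disjoint P Z₃)
    (hQ₁ : Disjoint Q Z₁) (hQ₂ : Disjoint Q Z₂) (hQ₃ : Disjoint Q Z₃) (h₁₂ : Disjoint Z₁ Z₂)
    (h₁₃ : Disjoint Z₁ Z₃) (h₂₃ : Disjoint Z₂ Z₃)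
    (tP₁ : G.Touches P Z₁) (tP₂ : G.Touches P Z₂) (tP₃ : G.Touches P Z₃)
    (tQ₁ : G.Touches Q Z₁) (tQ₂ : G.Touches Q Z₂) (tQ₃ : G.Touches Q Z₃) : False := by
  refine hG P Q ![Z₁, Z₂, Z₃] hP hQ ?_ hPQ ?_ ?_ ?_ ?_ ?_
  · intro i; fin_cases i; exacts [h₁, h₂, h₃]
  · intro i; fin_cases i; exacts [hP₁, hP₂, hP₃]
  · intro i; fin_cases i; exacts [hQ₁, hQ₂, hQ₃]
  · intro i j hij
    fin_cases i <;> fin_cases j <;> first | exact absurd rfl hij | skip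
    exacts [h₁₂, h₁₃, h₁₂.symm, h₂₃, h₁₃.symm, h₂₃.symm]
  · intro i; fin_cases i; exacts [tP₁, tP₂, tP₃]
  · intro i; fin_cases i; exacts [tQ₁, tQ₂, tQ₃]

theorem exists_min_card {p : Finset V → Prop} (h : ∃ K, p K) :
    ∃ K, p K ∧ ∀ K', p K' → K.card ≤ K'.card := by
  obtain ⟨K, hK, hmin⟩ := WellFounded.has_min (measure (Finset.card (α := V))).wf {K | p K} h
  exact ⟨K, hK, fun K' hK' => not_lt.1 (hmin K' hK')⟩

/-- Two disjoint connected sets have at most two common neighbours. -/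
theorem K23Free.card_common_le_two (hG : G.K23Free) {P Q R : Finset V} (hP : G.ConnOn P)
    (hQ : G.ConnOn Q) (hPQ : Disjoint P Q) (hRP : Disjoint R P) (hRQ : Disjoint R Q)
    (tP : ∀ r ∈ R, ∃ p ∈ P, G.Adj p r) (tQ : ∀ r ∈ R, ∃ q ∈ Q, G.Adj q r) : R.card ≤ 2 := by
  by_contra! h
  obtain ⟨a, ha, b, hb, c, hc, hab, hac, hbc⟩ := Finset.two_lt_card.1 h
  have touch : ∀ {T : Finset V} {r : V}, (∃ p ∈ T, G.Adj p r) → G.Touches T {r} := by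
    rintro T r ⟨p, hp, h⟩
    exact ⟨p, hp, r, by simp, h⟩
  have dis : ∀ {T : Finset V} {r : V}, Disjoint R T → r ∈ R → Disjoint T {r} := fun h hr => by
    rw [Finset.disjoint_singleton_right]
    exact Finset.disjoint_left.1 h hr
  exact hG.false hP hQ (.singleton a) (.singleton b) (.singleton c) hPQ (dis hRP ha) (dis hRP hb)
    (dis hRP hc) (dis hRQ ha) (dis hRQ hb) (dis hRQ hc) (by simpa) (by simpa) (by simpa)
    (touch (tP a ha)) (touch (tP b hb)) (touch (tP c hc)) (touch (tQ a ha)) (touch (tQ b hb))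
    (touch (tQ c hc))

variable [DecidableEq V]

theorem ClosedIn.sdiff (h : G.ClosedIn X Z) (h' : G.ClosedIn Y Z) : G.ClosedIn (X \ Y) Z := by
  refine ⟨Finset.sdiff_subset.trans h.1, fun x hx z hz hxz => ?_⟩
  rw [Finset.mem_sdiff] at hx ⊢
  exact ⟨h.2 x hx.1 z hz hxz, fun hzY => hx.2 (h'.2 z hzY x (h.1 hx.1) hxz.symm)⟩

theorem exists_component {x : V} (hx : x ∈ Y) : ∃ K, x ∈ K ∧ G.ConnOn K ∧ G.ClosedIn K Y := by
  classical
  let K := Y.filter fun y => ∀ A, G.ClosedIn A Y → x ∈ A → y ∈ A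
  have hxK : x ∈ K := Finset.mem_filter.2 ⟨hx, fun A _ h => h⟩
  have hK : G.ClosedIn K Y := by
    refine ⟨Finset.filter_subset _ _, fun y hy z hz hyz => ?_⟩
    exact Finset.mem_filter.2 ⟨hz, fun A hA hxA =>
      hA.2 y ((Finset.mem_filter.1 hy).2 A hA hxA) z hz hyz⟩
  refine ⟨K, hxK, ⟨⟨x, hxK⟩, fun B hB hne => ?_⟩, hK⟩
  have hBY := hB.trans hK
  have hxB : x ∈ B := by
    by_contra hxB
    obtain ⟨b, hb⟩ := hne
    have := (Finset.mem_filter.1 (hB.1 hb)).2 _ (hK.sdiff hBY) (Finset.mem_sdiff.2 ⟨hxK, hxB⟩)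
    exact (Finset.mem_sdiff.1 this).2 hb
  exact hB.1.antisymm fun y hy => (Finset.mem_filter.1 hy).2 B hBY hxB

/-- Deleting components of `H \ P` from a connected set `H` with a connected subset `P` leaves a
connected set. -/
theorem ConnOn.sdiff_component (hH : G.ConnOn H) (hP : G.ConnOn P) (hPH : P ⊆ H)
    (hK : G.ClosedIn K (H \ P)) : G.ConnOn (H \ K) := by
  have hPK : P ⊆ H \ K := fun p hp => Finset.mem_sdiff.2
    ⟨hPH hp, fun h => (Finset.mem_sdiff.1 (hK.1 h)).2 hp⟩
  refine ⟨hP.1.mono hPK, fun A hA hne => ?_⟩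
  obtain ⟨p, hp⟩ := hP.1
  -- A part of `H \ K` that avoids `P` has no neighbour in `K`.
  have hfar : ∀ y ∈ H \ K, y ∉ P → ∀ x ∈ H, G.Adj y x → x ∈ H \ K := fun y hy hyP x hx hyx => by
    rw [Finset.mem_sdiff] at hy ⊢
    exact ⟨hx, fun hxK => hy.2 (hK.2 x hxK y (Finset.mem_sdiff.2 ⟨hy.1, hyP⟩) hyx.symm)⟩
  by_cases hAP : (P ∩ A).Nonempty
  · have hPA : P ⊆ A := hP.subset_of_closedIn hPK hA hAP
    by_contra hne'
    have hB : ((H \ K) \ A).Nonempty := by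
      rw [Finset.sdiff_nonempty]
      exact fun h => hne' (hA.1.antisymm h)
    have := hH.2 ((H \ K) \ A) ⟨Finset.sdiff_subset.trans Finset.sdiff_subset,
      fun y hy x hx hyx => ?_⟩ hB
    · exact (Finset.mem_sdiff.1 (this ▸ hPH hp)).2 (hPA hp)
    · rw [Finset.mem_sdiff] at hy
      have hxK := hfar y hy.1 (fun h => hy.2 (hPA h)) x hx hyx
      exact Finset.mem_sdiff.2 ⟨hxK, fun hxA => hy.2 (hA.2 x hxA y hy.1 hyx.symm)⟩
  · rw [Finset.not_nonempty_iff_eq_empty, ← Finset.disjoint_iff_inter_eq_empty] at hAP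
    have := hH.2 A ⟨hA.1.trans Finset.sdiff_subset, fun y hy x hx hyx => hA.2 y hy x
      (hfar y (hA.1 hy) (Finset.disjoint_right.1 hAP hy) x hx hyx) hyx⟩ hne
    exact absurd (this ▸ hPH hp) (Finset.disjoint_left.1 hAP hp)

theorem inter_nonempty_of_card (hX : X ⊆ W) (hY : Y ⊆ W) (hX' : W.card < 2 * X.card)
    (hY' : W.card < 2 * Y.card) : (X ∩ Y).Nonempty := by
  rw [← Finset.card_pos]
  have h1 := Finset.card_union_add_card_inter X Y
  have h2 := Finset.card_le_card (Finset.union_subset hX hY)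
  omega

/-- A component that contains more than half of the vertices exists after the deletion of a few
vertices of `K`, if it exists after the deletion of these and of the boundary `B` of `K`. -/
theorem exists_big_component {S B T : Finset V} (hKW : K ⊆ W) (hK : W.card < 2 * K.card)
    (hB : ∀ k ∈ K, ∀ x ∈ W, G.Adj k x → x ∉ B → x ∈ K) (hBS : B ⊆ S) (hTS : T ⊆ S)
    (h : ∃ X ⊆ W \ S, G.ConnOn X ∧ W.card < 2 * X.card) :
    ∃ Y, G.ConnOn Y ∧ G.ClosedIn Y (K \ T) ∧ W.card < 2 * Y.card := by
  obtain ⟨X, hXW, hXc, hX⟩ := h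
  have hXW' : X ⊆ W := hXW.trans Finset.sdiff_subset
  have hne := inter_nonempty_of_card hXW' hKW hX hK
  have hXK : X ⊆ K := by
    have : X ∩ K = X := hXc.2 _ ⟨Finset.inter_subset_left, fun y hy x hx hyx => ?_⟩ hne
    · exact Finset.inter_eq_left.1 this
    · rw [Finset.mem_inter] at hy ⊢
      exact ⟨hx, hB y hy.2 x (hXW' hx) hyx fun h => (Finset.mem_sdiff.1 (hXW hx)).2 (hBS h)⟩
  have hXT : X ⊆ K \ T := fun x hx => Finset.mem_sdiff.2
    ⟨hXK hx, fun h => (Finset.mem_sdiff.1 (hXW hx)).2 (hTS h)⟩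
  obtain ⟨x, hx⟩ := hXc.1
  obtain ⟨Y, hxY, hYc, hY⟩ := G.exists_component (hXT hx)
  have := Finset.card_le_card (hXc.subset_of_closedIn hXT hY ⟨x, Finset.mem_inter.2 ⟨hx, hxY⟩⟩)
  exact ⟨Y, hYc, hY, by omega⟩

end Separator

section BalancedSeparator

variable {V : Type*} [DecidableEq V] {G : SimpleGraph V} {W : Finset V}

/-- If every deletion of at most five vertices leaves a component with more than half of the
vertices of `W`, there are a connected set `K` with more than half of the vertices and a disjoint
connected set `P` such that `K` sends edges to at most two vertices outside `K`, but the part of `K`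
not adjacent to `P` has small components only. To see this, take `K` minimal. -/
theorem K23Free.exists_core (hG : G.K23Free)
    (hno : ∀ S ⊆ W, S.card ≤ 5 → ∃ X ⊆ W \ S, G.ConnOn X ∧ W.card < 2 * X.card) :
    ∃ P K B R : Finset V, G.ConnOn P ∧ G.ConnOn K ∧ Disjoint P K ∧ K ⊆ W ∧ W.card < 2 * K.card ∧
      B ⊆ W ∧ B.card ≤ 2 ∧ (∀ k ∈ K, ∀ x ∈ W, G.Adj k x → x ∉ B → x ∈ K) ∧
      R ⊆ K ∧ R.Nonempty ∧ (∀ r ∈ R, ∃ p ∈ P, G.Adj p r) ∧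
      ∀ D ⊆ K \ R, G.ConnOn D → 2 * D.card ≤ W.card := by
  classical
  obtain ⟨X, hXW, hXc, hX⟩ := hno ∅ (by simp) (by simp)
  rw [Finset.sdiff_empty] at hXW
  obtain ⟨x, hx⟩ := hXc.1
  obtain ⟨H, hxH, hHc, hHW⟩ := G.exists_component (hXW hx)
  have hXH := hXc.subset_of_closedIn hXW hHW ⟨x, Finset.mem_inter.2 ⟨hx, hxH⟩⟩
  have hH : W.card < 2 * H.card := hX.trans_le (by have := Finset.card_le_card hXH; omega)
  -- Inside the component `H`, take `K` minimal such that both `K` and `P = H \ K` are connected.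
  let bd : Finset V → Finset V := fun K => (H \ K).filter fun v => ∃ k ∈ K, G.Adj k v
  let good : Finset V → Prop := fun K =>
    K ⊆ H ∧ G.ConnOn K ∧ G.ConnOn (H \ K) ∧ W.card < 2 * K.card ∧ (bd K).card ≤ 2
  have hgood : ∃ K, good K := by
    obtain ⟨K, hKc, hK, hKcard⟩ := exists_big_component (G := G) (B := ∅) (T := {x}) (S := {x})
      hHW.1 hH (fun k hk y hy hky _ => hHW.2 k hk y hy hky) (by simp) subset_rfl
      (hno {x} (by simpa using hXW hx) (by simp))
    have hxH' : {x} ⊆ H := by simpa using hxH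
    refine ⟨K, hK.1.trans Finset.sdiff_subset, hKc, hHc.sdiff_component (.singleton x) hxH' hK,
      hKcard, ?_⟩
    have : bd K ⊆ {x} := fun v hv => by
      by_contra hvx
      obtain ⟨hv, k, hk, hkv⟩ := Finset.mem_filter.1 hv
      rw [Finset.mem_sdiff] at hv
      exact hv.2 (hK.2 k hk v (Finset.mem_sdiff.2 ⟨hv.1, hvx⟩) hkv)
    exact (Finset.card_le_card this).trans (by simp)
  obtain ⟨K, ⟨hKH, hKc, hPc, hK, hbd⟩, hmin⟩ := exists_min_card hgood
  have hKW := hKH.trans hHW.1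
  let R := K.filter fun k => ∃ p ∈ H \ K, G.Adj p k
  have hRK : R ⊆ K := Finset.filter_subset _ _
  have hR : R.Nonempty := by
    by_contra hR
    rw [Finset.not_nonempty_iff_eq_empty] at hR
    have hKcl : G.ClosedIn K H := ⟨hKH, fun k hk y hy hky => by
      by_contra hyK
      have : k ∈ R := Finset.mem_filter.2 ⟨hk, y, Finset.mem_sdiff.2 ⟨hy, hyK⟩, hky.symm⟩
      simp [hR] at this⟩
    obtain ⟨p, hp⟩ := hPc.1
    rw [hHc.2 K hKcl hKc.1] at hp
    simp at hp
  refine ⟨H \ K, K, bd K, R, hPc, hKc, Finset.sdiff_disjoint, hKW, hK,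
    (Finset.filter_subset _ _).trans (Finset.sdiff_subset.trans hHW.1), hbd, ?_, hRK, hR,
    fun r hr => (Finset.mem_filter.1 hr).2, ?_⟩
  · intro k hk y hy hky hyB
    by_contra hyK
    exact hyB (Finset.mem_filter.2 ⟨Finset.mem_sdiff.2 ⟨hHW.2 k (hKH hk) y hy hky, hyK⟩, k, hk, hky⟩)
  · intro D hD hDc
    by_contra! hDcard
    -- A component of `K \ R` with more than half of the vertices would be smaller than `K`; its
    -- boundary lies in `R`, and these are common neighbours of `P` and the component.
    obtain ⟨d, hd⟩ := hDc.1
    obtain ⟨D', hdD', hD'c, hD'⟩ := G.exists_component (hD hd)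
    have hDD' := hDc.subset_of_closedIn hD hD' ⟨d, Finset.mem_inter.2 ⟨hd, hdD'⟩⟩
    have hD'K : D' ⊆ K := hD'.1.trans Finset.sdiff_subset
    have hPR : G.ConnOn ((H \ K) ∪ R) := by
      refine ⟨hPc.1.mono Finset.subset_union_left, fun A hA hne => ?_⟩
      have hPA : H \ K ⊆ A := by
        refine hPc.subset_of_closedIn Finset.subset_union_left hA ?_
        obtain ⟨a, ha⟩ := hne
        rcases Finset.mem_union.1 (hA.1 ha) with h | h
        · exact ⟨a, Finset.mem_inter.2 ⟨h, ha⟩⟩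
        · obtain ⟨p, hp, hpa⟩ := (Finset.mem_filter.1 h).2
          exact ⟨p, Finset.mem_inter.2 ⟨hp, hA.2 a ha p (Finset.mem_union_left _ hp) hpa.symm⟩⟩
      refine hA.1.antisymm (Finset.union_subset hPA fun r hr => ?_)
      obtain ⟨p, hp, hpr⟩ := (Finset.mem_filter.1 hr).2
      exact hA.2 p (hPA hp) r (Finset.mem_union_right _ hr) hpr
    have hset : H \ ((H \ K) ∪ R) = K \ R := by
      ext v
      simp only [Finset.mem_sdiff, Finset.mem_union]
      have := @hKH v
      tauto
    have hcompl : G.ConnOn (H \ D') := hHc.sdiff_component hPR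
      (Finset.union_subset Finset.sdiff_subset (hRK.trans hKH)) (by rwa [hset])
    have hbdR : bd D' ⊆ R := fun v hv => by
      obtain ⟨hv, k, hk, hkv⟩ := Finset.mem_filter.1 hv
      rw [Finset.mem_sdiff] at hv
      by_contra hvR
      by_cases hvK : v ∈ K
      · exact hv.2 (hD'.2 k hk v (Finset.mem_sdiff.2 ⟨hvK, hvR⟩) hkv)
      · exact (Finset.mem_sdiff.1 (hD'.1 hk)).2 (Finset.mem_filter.2
          ⟨hD'K hk, v, Finset.mem_sdiff.2 ⟨hv.1, hvK⟩, hkv.symm⟩)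
    have hbd2 : (bd D').card ≤ 2 := by
      refine hG.card_common_le_two hPc hD'c (Finset.disjoint_of_subset_right hD'K
        Finset.sdiff_disjoint) (Finset.disjoint_of_subset_left (hbdR.trans hRK)
        Finset.sdiff_disjoint.symm) ?_ (fun r hr => (Finset.mem_filter.1 (hbdR hr)).2)
        (fun r hr => (Finset.mem_filter.1 hr).2)
      rw [Finset.disjoint_left]
      exact fun r hr => (Finset.mem_sdiff.1 (Finset.mem_filter.1 hr).1).2
    have hle := hmin D' ⟨hD'K.trans hKH, hD'c, hcompl,
      hDcard.trans_le (by have := Finset.card_le_card hDD'; omega), hbd2⟩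
    obtain ⟨r, hr⟩ := hR
    have hlt : D'.card < K.card := Finset.card_lt_card ⟨hD'K, fun h =>
      (Finset.mem_sdiff.1 (hD'.1 (h (hRK hr)))).2 hr⟩
    omega

/-- A graph without `K₂,₃` minor has separators of at most five vertices that leave no component
with more than half of the vertices. Otherwise take a core `K`: three vertices of `K` adjacent to `P`
can be deleted in addition to the boundary of `K`, and the big components that remain yield a
`K₂,₃` minor. -/
theorem K23Free.exists_separator (hG : G.K23Free) (W : Finset V) :
    ∃ S ⊆ W, S.card ≤ 5 ∧ ∀ X ⊆ W \ S, G.ConnOn X → 2 * X.card ≤ W.card := by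
  classical
  by_contra! hno
  obtain ⟨P, K, B, R, hPc, hKc, hPK, hKW, hK, hBW, hB, hKB, hRK, hR, hRP, hsmall⟩ :=
    hG.exists_core hno
  have big : ∀ T ⊆ K, T.card ≤ 3 →
      ∃ Y, G.ConnOn Y ∧ G.ClosedIn Y (K \ T) ∧ W.card < 2 * Y.card := fun T hT hT3 =>
    exists_big_component hKW hK hKB Finset.subset_union_left Finset.subset_union_right
      (hno (B ∪ T) (Finset.union_subset hBW (hT.trans hKW))
        ((Finset.card_union_le _ _).trans (by omega)))
  have meetsR : ∀ Y ⊆ K, G.ConnOn Y → W.card < 2 * Y.card → ∃ r ∈ R, r ∈ Y := by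
    intro Y hY hYc hYcard
    by_contra! h
    have := hsmall Y (fun y hy => Finset.mem_sdiff.2 ⟨hY hy, fun hyR => h y hyR hy⟩) hYc
    omega
  have touchP : ∀ Y : Finset V, (∃ r ∈ R, r ∈ Y) → G.Touches P Y := by
    rintro Y ⟨r, hr, hrY⟩
    obtain ⟨p, hp, hpr⟩ := hRP r hr
    exact ⟨p, hp, r, hrY, hpr⟩
  have disP : ∀ Y ⊆ K, Disjoint P Y := fun Y hY => Finset.disjoint_of_subset_right hY hPK
  -- A big component `Y` of `K - w`, for `w ∈ R`, as small as possible.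
  obtain ⟨Y, ⟨w, hw, hYc, hY, hYcard⟩, hYmin⟩ := exists_min_card (V := V)
    (p := fun Y => ∃ w ∈ R, G.ConnOn Y ∧ G.ClosedIn Y (K \ {w}) ∧ W.card < 2 * Y.card) (by
      obtain ⟨w, hw⟩ := hR
      obtain ⟨Y, h⟩ := big {w} (by simpa using hRK hw) (by simp)
      exact ⟨Y, w, hw, h⟩)
  have hYK : Y ⊆ K := hY.1.trans Finset.sdiff_subset
  have hwY : w ∉ Y := fun h => by simpa using hY.1 h
  have hwK := hRK hw
  -- A neighbour of `w` in `Y`.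
  obtain ⟨y, hyY, hwy⟩ : ∃ y ∈ Y, G.Adj w y := by
    by_contra! h
    have hcl : G.ClosedIn Y K := ⟨hYK, fun y hy x hx hyx => by
      by_cases hxw : x = w
      · exact absurd (hxw ▸ hyx).symm (h y hy)
      · exact hY.2 y hy x (by simp [hx, hxw]) hyx⟩
    exact hwY (hKc.2 Y hcl hYc.1 ▸ hwK)
  -- A connected set `L` in `Y` next to `w`, with one vertex `w'` of `R`.
  obtain ⟨w', L, hw'R, hw'Y, hw'L, hLY, hLc, hwL, hLcl⟩ : ∃ (w' : V) (L : Finset V), w' ∈ R ∧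
      w' ∈ Y ∧ w' ∈ L ∧ L ⊆ Y ∧ G.ConnOn L ∧ G.Touches {w} L ∧
      ∀ Y', G.ConnOn Y' → Y' ⊆ K \ {w, w'} → W.card < 2 * Y'.card → Disjoint L Y' := by
    by_cases hyR : y ∈ R
    · refine ⟨y, {y}, hyR, hyY, by simp, by simpa, .singleton y, ⟨w, by simp, y, by simp, hwy⟩, ?_⟩
      intro Y' _ hY' _
      rw [Finset.disjoint_singleton_left]
      exact fun h => by simpa using hY' h
    · obtain ⟨D, hyD, hDc, hD⟩ := G.exists_component (Finset.mem_sdiff.2 ⟨hYK hyY, hyR⟩)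
      have hDK : D ⊆ K := hD.1.trans Finset.sdiff_subset
      have hDR : ∀ d ∈ D, d ∉ R := fun d hd => (Finset.mem_sdiff.1 (hD.1 hd)).2
      have hDY : D ⊆ Y := hDc.subset_of_closedIn (fun d hd => by
        have : d ≠ w := fun h => hDR d hd (h ▸ hw)
        simp [hDK hd, this]) hY ⟨y, Finset.mem_inter.2 ⟨hyD, hyY⟩⟩
      have hDsmall := hsmall D hD.1 hDc
      obtain ⟨d, hd, w', hw'Y, hw'D, hdw'⟩ : ∃ d ∈ D, ∃ w' ∈ Y, w' ∉ D ∧ G.Adj d w' := by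
        by_contra! h
        have := hYc.2 D ⟨hDY, fun d hd x hx hdx => by
          by_contra hxD
          exact h d hd x hx hxD hdx⟩ hDc.1
        rw [this] at hDsmall
        omega
      have hw'R : w' ∈ R := by
        by_contra h
        exact hw'D (hD.2 d hd w' (Finset.mem_sdiff.2 ⟨hYK hw'Y, h⟩) hdw')
      have hww' : w ≠ w' := fun h => hwY (h ▸ hw'Y)
      refine ⟨w', {w'} ∪ D, hw'R, hw'Y, by simp, Finset.union_subset (by simpa) hDY,
        (ConnOn.singleton w').union hDc ⟨w', by simp, d, hd, hdw'.symm⟩,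
        ⟨w, by simp, y, by simp [hyD], hwy⟩, fun Y' hY'c hY' hY'card => ?_⟩
      -- `D` has no neighbours in `K` except `w` and `w'`, so it is a component of `K - w - w'`.
      have hDcl : G.ClosedIn D (K \ {w, w'}) := by
        refine ⟨fun x hx => ?_, fun x hx z hz hxz => ?_⟩
        · have h1 : x ≠ w := fun h => hDR x hx (h ▸ hw)
          have h2 : x ≠ w' := fun h => hDR x hx (h ▸ hw'R)
          simp [hDK hx, h1, h2]
        · by_contra hzD
          simp only [Finset.mem_sdiff, Finset.mem_insert, Finset.mem_singleton, not_or] at hz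
          have hzR : z ∈ R := by
            by_contra h
            exact hzD (hD.2 x hx z (Finset.mem_sdiff.2 ⟨hz.1, h⟩) hxz)
          have h3 : ({w, w', z} : Finset V).card = 3 := by
            rw [Finset.card_eq_three]
            exact ⟨w, w', z, hww', fun h => hz.2.1 h.symm, fun h => hz.2.2 h.symm, rfl⟩
          have hsub : ∀ v ∈ ({w, w', z} : Finset V), v ∈ R := by
            simp [hw, hw'R, hzR]
          have hle := hG.card_common_le_two (R := {w, w', z}) hPc hDc (disP D hDK)
            (Finset.disjoint_left.2 fun v hv hvP =>
              Finset.disjoint_left.1 hPK hvP (hRK (hsub v hv)))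
            (Finset.disjoint_left.2 fun v hv hvD => hDR v hvD (hsub v hv))
            (fun v hv => hRP v (hsub v hv)) (by
              intro v hv
              simp only [Finset.mem_insert, Finset.mem_singleton] at hv
              rcases hv with rfl | rfl | rfl
              exacts [⟨y, hyD, hwy.symm⟩, ⟨d, hd, hdw'⟩, ⟨x, hx, hxz⟩])
          omega
      rw [Finset.disjoint_union_left, Finset.disjoint_singleton_left]
      refine ⟨fun h => by simpa using hY' h, ?_⟩
      by_contra h
      rw [Finset.not_disjoint_iff] at h
      obtain ⟨x, hxD, hxY'⟩ := h
      have := Finset.card_le_card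
        (hY'c.subset_of_closedIn hY' hDcl ⟨x, Finset.mem_inter.2 ⟨hxY', hxD⟩⟩)
      omega
  have hw'K := hYK hw'Y
  have hLK := hLY.trans hYK
  have hww' : w ≠ w' := fun h => hwY (h ▸ hw'Y)
  have hwL' : w ∉ L := fun h => hwY (hLY h)
  -- A big component `Y₂` of `K - w - w'`.
  obtain ⟨Y₂, hY₂c, hY₂, hY₂card⟩ := big {w, w'} (by
    intro v hv
    simp only [Finset.mem_insert, Finset.mem_singleton] at hv
    rcases hv with rfl | rfl
    exacts [hwK, hw'K]) (Finset.card_le_two.trans (by norm_num))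
  have hY₂K : Y₂ ⊆ K := hY₂.1.trans Finset.sdiff_subset
  have hwY₂ : w ∉ Y₂ := fun h => by simpa using hY₂.1 h
  have hw'Y₂ : w' ∉ Y₂ := fun h => by simpa using hY₂.1 h
  have hLY₂ := hLcl Y₂ hY₂c hY₂.1 hY₂card
  have hY₂Y : Y₂ ⊆ Y := hY₂c.subset_of_closedIn (X := K \ {w}) (fun v hv => by
    have : v ≠ w := fun h => hwY₂ (h ▸ hv)
    simp [hY₂K hv, this]) hY (inter_nonempty_of_card (hY₂K.trans hKW) (hYK.trans hKW) hY₂card hYcard)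
  have hltY : ∀ Y', Y' ⊆ Y₂ → Y'.card < Y.card := fun Y' h =>
    (Finset.card_le_card h).trans_lt (Finset.card_lt_card ⟨hY₂Y, fun h => hw'Y₂ (h hw'Y)⟩)
  obtain ⟨y₁, hy₁, hy₁w⟩ : ∃ y ∈ Y₂, G.Adj y w := by
    by_contra! h
    have := hYmin Y₂ ⟨w', hw'R, hY₂c, ⟨fun v hv => by
      have : v ≠ w' := fun h => hw'Y₂ (h ▸ hv)
      simp [hY₂K hv, this], fun v hv x hx hvx => by
      simp only [Finset.mem_sdiff, Finset.mem_singleton] at hx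
      have hxw : x ≠ w := fun hxw => h v hv (hxw ▸ hvx)
      exact hY₂.2 v hv x (by simp [hx, hxw]) hvx⟩, hY₂card⟩
    have := hltY Y₂ subset_rfl
    omega
  obtain ⟨y₂, hy₂, hy₂w⟩ : ∃ y ∈ Y₂, G.Adj y w' := by
    by_contra! h
    have := hYc.2 Y₂ ⟨hY₂Y, fun v hv x hx hvx => by
      have hxw : x ≠ w := fun hxw => hwY (hxw ▸ hx)
      have hxw' : x ≠ w' := fun hxw => h v hv (hxw ▸ hvx)
      exact hY₂.2 v hv x (by simp [hYK hx, hxw, hxw']) hvx⟩ hY₂c.1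
    exact hw'Y₂ (this ▸ hw'Y)
  -- Split `Y₂` at a vertex `z ∈ R` into a big component `Y₃` of `K - w - w' - z` and the rest `F`.
  obtain ⟨z, hzR, hzY₂⟩ := meetsR Y₂ hY₂K hY₂c hY₂card
  have hzw : z ≠ w := fun h => hwY₂ (h ▸ hzY₂)
  have hzw' : z ≠ w' := fun h => hw'Y₂ (h ▸ hzY₂)
  obtain ⟨Y₃, hY₃c, hY₃, hY₃card⟩ := big {w, w', z} (by
    intro v hv
    simp only [Finset.mem_insert, Finset.mem_singleton] at hv
    rcases hv with rfl | rfl | rfl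
    exacts [hwK, hw'K, hRK hzR]) Finset.card_le_three
  have hY₃K : Y₃ ⊆ K := hY₃.1.trans Finset.sdiff_subset
  have hzY₃ : z ∉ Y₃ := fun h => by simpa using hY₃.1 h
  have hY₃Y₂ : Y₃ ⊆ Y₂ := hY₃c.subset_of_closedIn (X := K \ {w, w'}) (fun v hv => by
    have := hY₃.1 hv
    simp only [Finset.mem_sdiff, Finset.mem_insert, Finset.mem_singleton, not_or] at this ⊢
    tauto) hY₂ (inter_nonempty_of_card (hY₃K.trans hKW) (hY₂K.trans hKW) hY₃card hY₂card)
  have hwY₃ : w ∉ Y₃ := fun h => hwY₂ (hY₃Y₂ h)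
  have hLY₃ : Disjoint L Y₃ := Finset.disjoint_of_subset_right hY₃Y₂ hLY₂
  have hY₃cl : G.ClosedIn Y₃ (Y₂ \ {z}) := ⟨fun v hv => by
    have : v ≠ z := fun h => hzY₃ (h ▸ hv)
    simp [hY₃Y₂ hv, this], fun v hv x hx hvx => by
    simp only [Finset.mem_sdiff, Finset.mem_singleton] at hx
    refine hY₃.2 v hv x ?_ hvx
    have := hY₂.1 hx.1
    simp only [Finset.mem_sdiff, Finset.mem_insert, Finset.mem_singleton, not_or] at this ⊢
    tauto⟩
  have hFc : G.ConnOn (Y₂ \ Y₃) := hY₂c.sdiff_component (.singleton z) (by simpa) hY₃cl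
  have hzF : z ∈ Y₂ \ Y₃ := Finset.mem_sdiff.2 ⟨hzY₂, hzY₃⟩
  have hFK : Y₂ \ Y₃ ⊆ K := Finset.sdiff_subset.trans hY₂K
  have hwF : Disjoint {w} (Y₂ \ Y₃) :=
    Finset.disjoint_singleton_left.2 fun h => hwY₂ (Finset.sdiff_subset h)
  have hLF : Disjoint L (Y₂ \ Y₃) := Finset.disjoint_of_subset_right Finset.sdiff_subset hLY₂
  obtain ⟨y₃, hy₃, hy₃z⟩ : ∃ y ∈ Y₃, G.Adj y z := by
    by_contra! h
    have := hY₂c.2 Y₃ ⟨hY₃Y₂, fun v hv x hx hvx => by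
      have hxz : x ≠ z := fun hxz => h v hv (hxz ▸ hvx)
      exact hY₃cl.2 v hv x (by simp [hx, hxz]) hvx⟩ hY₃c.1
    exact hzY₃ (this ▸ hzY₂)
  have hPY₃ : G.Touches P Y₃ := touchP _ (meetsR Y₃ hY₃K hY₃c hY₃card)
  have hPw : G.Touches P {w} := touchP _ ⟨w, hw, by simp⟩
  have hPL : G.Touches P L := touchP _ ⟨w', hw'R, hw'L⟩
  have hPF : G.Touches P (Y₂ \ Y₃) := touchP _ ⟨z, hzR, hzF⟩
  have hY₃F : G.Touches Y₃ (Y₂ \ Y₃) := ⟨y₃, hy₃, z, hzF, hy₃z⟩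
  -- If `Y₃` touches `w` or `L`, there is a `K₂,₃` minor on the sets `P`, `Y₃`, `{w}`, `L`, `F`;
  -- otherwise `Y₃` is a component of `K - z`, against the choice of `Y`.
  by_cases h1 : ∃ y ∈ Y₃, G.Adj y w <;> by_cases h2 : ∃ y ∈ Y₃, G.Adj y w'
  · obtain ⟨a, ha, haw⟩ := h1
    obtain ⟨b, hb, hbw⟩ := h2
    exact hG.false hPc hY₃c (.singleton w) hLc hFc (disP _ hY₃K) (disP _ (by simpa))
      (disP _ hLK) (disP _ hFK) (by simpa) hLY₃.symm Finset.disjoint_sdiff (by simpa) hwF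
      hLF hPw hPL hPF ⟨a, ha, w, by simp, haw⟩ ⟨b, hb, w', hw'L, hbw⟩ hY₃F
  · obtain ⟨a, ha, haw⟩ := h1
    have hLF' : G.Touches L (Y₂ \ Y₃) :=
      ⟨w', hw'L, y₂, Finset.mem_sdiff.2 ⟨hy₂, fun h => h2 ⟨y₂, h, hy₂w⟩⟩, hy₂w.symm⟩
    exact hG.false hLc hY₃c (.singleton w) hFc hPc hLY₃ (by simpa) hLF (disP _ hLK).symm
      (by simpa) Finset.disjoint_sdiff (disP _ hY₃K).symm hwF (disP _ (by simpa)).symm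
      (disP _ hFK).symm hwL.symm hLF' hPL.symm ⟨a, ha, w, by simp, haw⟩ hY₃F hPY₃.symm
  · obtain ⟨b, hb, hbw⟩ := h2
    have hwF' : G.Touches {w} (Y₂ \ Y₃) :=
      ⟨w, by simp, y₁, Finset.mem_sdiff.2 ⟨hy₁, fun h => h1 ⟨y₁, h, hy₁w⟩⟩, hy₁w.symm⟩
    exact hG.false (.singleton w) hY₃c hLc hFc hPc (by simpa) (by simpa) hwF
      (disP _ (by simpa)).symm hLY₃.symm Finset.disjoint_sdiff (disP _ hY₃K).symm hLF
      (disP _ hLK).symm (disP _ hFK).symm hwL hwF' hPw.symm ⟨b, hb, w', hw'L, hbw⟩ hY₃F hPY₃.symm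
  · push Not at h1 h2
    have := hYmin Y₃ ⟨z, hzR, hY₃c, ⟨fun v hv => by
      have : v ≠ z := fun h => hzY₃ (h ▸ hv)
      simp [hY₃K hv, this], fun v hv x hx hvx => by
      simp only [Finset.mem_sdiff, Finset.mem_singleton] at hx
      have hxw : x ≠ w := fun hxw => h1 v hv (hxw ▸ hvx)
      have hxw' : x ≠ w' := fun hxw => h2 v hv (hxw ▸ hvx)
      exact hY₃.2 v hv x (by simp [hx, hxw, hxw']) hvx⟩, hY₃card⟩
    have := hltY Y₃ hY₃Y₂
    omega

/-- A graph without `K₂,₃` minor can be split into two parts of at most two thirds of the vertices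
by the deletion of at most five vertices. -/
theorem K23Free.exists_balanced_separation (hG : G.K23Free) (W : Finset V)
    (hW : 15 ≤ W.card) : ∃ A B S : Finset V, A ∪ B ∪ S = W ∧ Disjoint A B ∧ Disjoint A S ∧
      Disjoint B S ∧ S.card ≤ 5 ∧ 3 * A.card ≤ 2 * W.card ∧ 3 * B.card ≤ 2 * W.card ∧
      ∀ a ∈ A, ∀ b ∈ B, ¬ G.Adj a b := by
  obtain ⟨S, hSW, hS, hsep⟩ := hG.exists_separator W
  have hcard : (W \ S).card = W.card - S.card := Finset.card_sdiff_of_subset hSW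
  obtain ⟨A, ⟨hA, hAcard⟩, hmin⟩ := exists_min_card (V := V)
    (p := fun A => G.ClosedIn A (W \ S) ∧ W.card ≤ 3 * A.card)
    ⟨W \ S, ⟨subset_rfl, fun _ _ _ h _ => h⟩, by omega⟩
  have hAle : 3 * A.card ≤ 2 * W.card := by
    by_contra! hlt
    obtain ⟨a, ha⟩ : A.Nonempty := Finset.card_pos.1 (by omega)
    -- Without one of its components, `A` is too small, so that component could replace `A`.
    obtain ⟨C, haC, hCc, hC⟩ := G.exists_component ha
    have hC' := hC.trans hA
    have hCsmall := hsep C hC'.1 hCc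
    have hcardC : (A \ C).card = A.card - C.card := Finset.card_sdiff_of_subset hC.1
    have hpos : 0 < C.card := Finset.card_pos.2 ⟨a, haC⟩
    have hle := Finset.card_le_card hC.1
    have h1 : ¬ W.card ≤ 3 * (A \ C).card := fun h => by
      have := hmin _ ⟨hA.sdiff hC', h⟩
      omega
    have h2 := hmin C ⟨hC', by omega⟩
    omega
  have hcardB : ((W \ S) \ A).card = (W \ S).card - A.card := Finset.card_sdiff_of_subset hA.1
  have hAS : Disjoint A S := Finset.disjoint_of_subset_left hA.1 Finset.sdiff_disjoint
  refine ⟨A, (W \ S) \ A, S, ?_, Finset.disjoint_sdiff, hAS,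
    Finset.disjoint_of_subset_left Finset.sdiff_subset Finset.sdiff_disjoint, hS, hAle,
    by omega, fun a ha b hb hab => ?_⟩
  · rw [Finset.union_sdiff_of_subset hA.1, Finset.sdiff_union_of_subset hSW]
  · rw [Finset.mem_sdiff] at hb
    exact hb.2 (hA.2 a ha b hb.1 hab)

end BalancedSeparator

end SimpleGraph

/-! ### Few coincidences in graphs without `K₂,₃` minor -/

namespace SimpleGraph

section Coincidences

variable {V : Type*} {G : SimpleGraph V}

theorem K23Free.card_common_neighbors_le_two (hG : G.K23Free) {p q : V} (hpq : p ≠ q)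
    {R : Finset V} (hR : ∀ r ∈ R, G.Adj p r ∧ G.Adj q r) : R.card ≤ 2 :=
  hG.card_common_le_two (.singleton p) (.singleton q) (by simpa)
    (Finset.disjoint_singleton_right.2 fun h => (hR p h).1.ne rfl)
    (Finset.disjoint_singleton_right.2 fun h => (hR q h).2.ne rfl)
    (fun r hr => ⟨p, by simp, (hR r hr).1⟩) fun r hr => ⟨q, by simp, (hR r hr).2⟩

/-- Among the paths `p - a - c a - q`, with `a` not adjacent to `q`, at most two values of `c a`
occur, since paths with distinct values of `c a` are internally disjoint. -/
theorem K23Free.card_image_le_two [DecidableEq V] (hG : G.K23Free) {p q : V} (hpq : p ≠ q)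
    {R : Finset V} {c : V → V}
    (hR : ∀ a ∈ R, G.Adj p a ∧ ¬ G.Adj q a ∧ a ≠ q ∧ c a ≠ p ∧ G.Adj a (c a) ∧ G.Adj q (c a)) :
    (R.image c).card ≤ 2 := by
  by_contra! h
  obtain ⟨x, hx, y, hy, z, hz, hxy, hxz, hyz⟩ := Finset.two_lt_card.1 h
  obtain ⟨a₁, h₁, rfl⟩ := Finset.mem_image.1 hx
  obtain ⟨a₂, h₂, rfl⟩ := Finset.mem_image.1 hy
  obtain ⟨a₃, h₃, rfl⟩ := Finset.mem_image.1 hz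
  have dis : ∀ a ∈ R, ∀ b ∈ R, c a ≠ c b → Disjoint ({a, c a} : Finset V) {b, c b} := by
    intro a ha b hb hab
    have h1 : a ≠ b := fun h => hab (h ▸ rfl)
    have h2 : a ≠ c b := fun h => (hR a ha).2.1 (h ▸ (hR b hb).2.2.2.2.2)
    have h3 : c a ≠ b := fun h => (hR b hb).2.1 (h ▸ (hR a ha).2.2.2.2.2)
    simp [h1.symm, h3.symm]
    tauto
  have disp : ∀ a ∈ R, Disjoint ({p} : Finset V) {a, c a} := fun a ha => by
    simp [(hR a ha).1.ne, (hR a ha).2.2.2.1.symm]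
  have disq : ∀ a ∈ R, Disjoint ({q} : Finset V) {a, c a} := fun a ha => by
    simp [(hR a ha).2.2.1.symm, (hR a ha).2.2.2.2.2.ne]
  have tp : ∀ a ∈ R, G.Touches {p} {a, c a} := fun a ha =>
    ⟨p, by simp, a, by simp, (hR a ha).1⟩
  have tq : ∀ a ∈ R, G.Touches {q} {a, c a} := fun a ha =>
    ⟨q, by simp, c a, by simp, (hR a ha).2.2.2.2.2⟩
  have conn : ∀ a ∈ R, G.ConnOn {a, c a} := fun a ha => .pair (hR a ha).2.2.2.2.1
  exact hG.false (.singleton p) (.singleton q) (conn _ h₁) (conn _ h₂) (conn _ h₃) (by simpa)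
    (disp _ h₁) (disp _ h₂) (disp _ h₃) (disq _ h₁) (disq _ h₂) (disq _ h₃) (dis _ h₁ _ h₂ hxy)
    (dis _ h₁ _ h₃ hxz) (dis _ h₂ _ h₃ hyz) (tp _ h₁) (tp _ h₂) (tp _ h₃) (tq _ h₁) (tq _ h₂)
    (tq _ h₃)

/-- The paths `p - a - c - q` have at most two values of `c`, and `p` and `c` have at most two common
neighbours `a`. -/
theorem K23Free.card_path_le_four (hG : G.K23Free) {p q : V} (hpq : p ≠ q) {R : Finset V}
    (hR : ∀ a ∈ R, G.Adj p a ∧ ¬ G.Adj q a ∧ a ≠ q ∧ ∃ c ≠ p, G.Adj a c ∧ G.Adj q c) :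
    R.card ≤ 4 := by
  classical
  choose! c hc using fun a ha => (hR a ha).2.2.2
  have himg := hG.card_image_le_two hpq (c := c) fun a ha =>
    ⟨(hR a ha).1, (hR a ha).2.1, (hR a ha).2.2.1, hc a ha⟩
  have hfib : ∀ x ∈ R.image c, (R.filter fun a => c a = x).card ≤ 2 := by
    intro x hx
    obtain ⟨a, ha, rfl⟩ := Finset.mem_image.1 hx
    refine hG.card_common_neighbors_le_two (hc a ha).1 fun b hb => ?_
    rw [Finset.mem_filter] at hb
    exact ⟨hb.2 ▸ (hc b hb.1).2.1.symm, (hR b hb.1).1⟩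
  have := Finset.card_le_mul_card_image R 2 hfib
  omega

/-- If `p` and `q` are adjacent, then `q` is one more common neighbour of `p` and `c`, so `c`
determines `a`. -/
theorem K23Free.card_path_le_two (hG : G.K23Free) {p q : V} (hpq : G.Adj p q) {R : Finset V}
    (hR : ∀ a ∈ R, G.Adj p a ∧ ¬ G.Adj q a ∧ a ≠ q ∧ ∃ c ≠ p, G.Adj a c ∧ G.Adj q c) :
    R.card ≤ 2 := by
  classical
  choose! c hc using fun a ha => (hR a ha).2.2.2
  have himg := hG.card_image_le_two hpq.ne (c := c) fun a ha =>
    ⟨(hR a ha).1, (hR a ha).2.1, (hR a ha).2.2.1, hc a ha⟩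
  have hinj : Set.InjOn c R := by
    intro a ha b hb hab
    by_contra hne
    have h3 : ({q, a, b} : Finset V).card = 3 := Finset.card_eq_three.2
      ⟨q, a, b, (hR a ha).2.2.1.symm, (hR b hb).2.2.1.symm, hne, rfl⟩
    have := hG.card_common_neighbors_le_two (R := {q, a, b}) (hc a ha).1 (by
      intro r hr
      simp only [Finset.mem_insert, Finset.mem_singleton] at hr
      rcases hr with rfl | rfl | rfl
      · exact ⟨(hc a ha).2.2.symm, hpq⟩
      · exact ⟨(hc r ha).2.1.symm, (hR r ha).1⟩
      · exact ⟨hab ▸ (hc r hb).2.1.symm, (hR r hb).1⟩)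
    omega
  rwa [Finset.card_image_of_injOn hinj] at himg

/-- There are few vertices `a` with two paths `s - c - a` and `s' - c' - a` for distinct `c`, `c'`:
among `33` of them, three would form disjoint connections of `s` and `s'`. -/
theorem K23Free.card_two_paths_le (hG : G.K23Free) {s s' : V} (hss' : s ≠ s') {R : Finset V}
    (hR : ∀ a ∈ R, ¬ G.Adj s a ∧ ¬ G.Adj s' a ∧ a ≠ s ∧ a ≠ s' ∧ ∃ c c', c ≠ c' ∧ c ≠ s' ∧ c' ≠ s ∧
      G.Adj s c ∧ G.Adj c a ∧ G.Adj s' c' ∧ G.Adj c' a) : R.card ≤ 32 := by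
  classical
  choose! c c' hc using fun a ha => (hR a ha).2.2.2.2
  have hfib : ∀ x, (R.filter fun a => c a = x).card ≤ 4 := by
    intro x
    by_cases hx : x = s'
    · rw [Finset.filter_false_of_mem]
      · simp
      · exact fun a ha h => (hc a ha).2.1 (h.trans hx)
    refine hG.card_path_le_four hx fun a ha => ?_
    rw [Finset.mem_filter] at ha
    obtain ⟨ha, rfl⟩ := ha
    obtain ⟨h1, h2, h3, h4, h5, h6, h7⟩ := hc a ha
    exact ⟨h5, (hR a ha).2.1, (hR a ha).2.2.2.1, c' a, h1.symm, h7.symm, h6⟩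
  have hfib' : ∀ x, (R.filter fun a => c' a = x).card ≤ 4 := by
    intro x
    by_cases hx : x = s
    · rw [Finset.filter_false_of_mem]
      · simp
      · exact fun a ha h => (hc a ha).2.2.1 (h.trans hx)
    refine hG.card_path_le_four hx fun a ha => ?_
    rw [Finset.mem_filter] at ha
    obtain ⟨ha, rfl⟩ := ha
    obtain ⟨h1, h2, h3, h4, h5, h6, h7⟩ := hc a ha
    exact ⟨h7, (hR a ha).1, (hR a ha).2.2.1, c a, h1, h5.symm, h4⟩
  -- The vertices whose paths meet the paths of `a`: at most `4 * 4` of them.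
  let conf : V → Finset V := fun a => ((R.filter fun b => c b = c a) ∪ (R.filter fun b => c b = c' a))
    ∪ ((R.filter fun b => c' b = c a) ∪ (R.filter fun b => c' b = c' a))
  have hconf : ∀ a, (conf a).card ≤ 16 := fun a => by
    have h1 := Finset.card_union_le (R.filter fun b => c b = c a) (R.filter fun b => c b = c' a)
    have h2 := Finset.card_union_le (R.filter fun b => c' b = c a) (R.filter fun b => c' b = c' a)
    have h3 := Finset.card_union_le
      ((R.filter fun b => c b = c a) ∪ (R.filter fun b => c b = c' a))
      ((R.filter fun b => c' b = c a) ∪ (R.filter fun b => c' b = c' a))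
    have := hfib (c a)
    have := hfib (c' a)
    have := hfib' (c a)
    have := hfib' (c' a)
    simp only [conf]
    omega
  by_contra! hcard
  obtain ⟨a₁, h₁⟩ : R.Nonempty := Finset.card_pos.1 (by omega)
  have hc1 := Finset.le_card_sdiff (conf a₁) R
  have := hconf a₁
  obtain ⟨a₂, h₂⟩ : (R \ conf a₁).Nonempty := Finset.card_pos.1 (by omega)
  have hc2 := Finset.le_card_sdiff (conf a₂) (R \ conf a₁)
  have := hconf a₂
  obtain ⟨a₃, h₃⟩ : ((R \ conf a₁) \ conf a₂).Nonempty := Finset.card_pos.1 (by omega)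
  simp only [Finset.mem_sdiff] at h₂ h₃
  have conn : ∀ a ∈ R, G.ConnOn ({c a, a} ∪ {c' a}) := fun a ha =>
    (ConnOn.pair (hc a ha).2.2.2.2.1).union (.singleton _)
      ⟨a, by simp, c' a, by simp, (hc a ha).2.2.2.2.2.2.symm⟩
  have dis : ∀ a ∈ R, ∀ b ∈ R, b ∉ conf a →
      Disjoint ({c a, a} ∪ {c' a} : Finset V) ({c b, b} ∪ {c' b}) := by
    intro a ha b hb hab
    simp only [conf, Finset.mem_union, Finset.mem_filter, hb, true_and, not_or] at hab
    obtain ⟨ha1, ha2, ha3, ha4, -⟩ := hR a ha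
    obtain ⟨hb1, hb2, hb3, hb4, -⟩ := hR b hb
    obtain ⟨-, -, -, h4, h5, h6, h7⟩ := hc a ha
    obtain ⟨-, -, -, h4', h5', h6', h7'⟩ := hc b hb
    rw [Finset.disjoint_left]
    intro v hv hv'
    simp only [Finset.mem_union, Finset.mem_insert, Finset.mem_singleton] at hv hv'
    grind
  have diss : ∀ a ∈ R, Disjoint ({s} : Finset V) ({c a, a} ∪ {c' a}) := fun a ha => by
    rw [Finset.disjoint_singleton_left]
    simp [(hc a ha).2.2.2.1.ne, (hR a ha).2.2.1.symm, (hc a ha).2.2.1.symm]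
  have diss' : ∀ a ∈ R, Disjoint ({s'} : Finset V) ({c a, a} ∪ {c' a}) := fun a ha => by
    rw [Finset.disjoint_singleton_left]
    simp [(hc a ha).2.1.symm, (hR a ha).2.2.2.1.symm, (hc a ha).2.2.2.2.2.1.ne]
  have ts : ∀ a ∈ R, G.Touches {s} ({c a, a} ∪ {c' a}) := fun a ha =>
    ⟨s, by simp, c a, by simp, (hc a ha).2.2.2.1⟩
  have ts' : ∀ a ∈ R, G.Touches {s'} ({c a, a} ∪ {c' a}) := fun a ha =>
    ⟨s', by simp, c' a, by simp, (hc a ha).2.2.2.2.2.1⟩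
  exact hG.false (.singleton s) (.singleton s') (conn _ h₁) (conn _ h₂.1) (conn _ h₃.1.1)
    (by simpa) (diss _ h₁) (diss _ h₂.1) (diss _ h₃.1.1) (diss' _ h₁) (diss' _ h₂.1)
    (diss' _ h₃.1.1) (dis _ h₁ _ h₂.1 h₂.2) (dis _ h₁ _ h₃.1.1 h₃.1.2)
    (dis _ h₂.1 _ h₃.1.1 h₃.2) (ts _ h₁) (ts _ h₂.1) (ts _ h₃.1.1) (ts' _ h₁) (ts' _ h₂.1)
    (ts' _ h₃.1.1)

end Coincidences

end SimpleGraph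

/-! ### Induced paths that cross a separation -/

namespace SimpleGraph

section Crossing

open Classical

variable {V : Type*} {G : SimpleGraph V}

/-- `a, b, c, d` are the successive vertices of an induced path on four vertices. -/
def IsInducedP4 (G : SimpleGraph V) (a b c d : V) : Prop :=
  G.Adj a b ∧ G.Adj b c ∧ G.Adj c d ∧ ¬ G.Adj a c ∧ ¬ G.Adj b d ∧ ¬ G.Adj a d ∧ a ≠ c ∧ b ≠ d

theorem IsInducedP4.reverse {a b c d : V} (h : G.IsInducedP4 a b c d) : G.IsInducedP4 d c b a := by
  obtain ⟨h1, h2, h3, h4, h5, h6, h7, h8⟩ := h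
  exact ⟨h3.symm, h2.symm, h1.symm, fun h => h5 h.symm, fun h => h4 h.symm, fun h => h6 h.symm,
    h8.symm, h7.symm⟩

/-- The number of induced paths `s - c - d` with `c ∈ X`. -/
noncomputable def cherries (G : SimpleGraph V) (X : Finset V) (s d : V) : ℕ :=
  (X.filter fun c => G.Adj s c ∧ G.Adj c d ∧ ¬ G.Adj s d).card

/-- With respect to a separator `S`, the vertex `a` of the side `X` is exceptional if it has two
neighbours in `S`, or one neighbour in `S` and an induced path through `X` to another vertex
of `S`, or two disjoint such paths to different vertices of `S`. -/
def IsExceptional (G : SimpleGraph V) (S X : Finset V) (a : V) : Prop :=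
  ∃ s ∈ S, ∃ s' ∈ S, s ≠ s' ∧ ((G.Adj s a ∧ G.Adj s' a) ∨
    (G.Adj s a ∧ ¬ G.Adj s' a ∧ ∃ c ∈ X, G.Adj s' c ∧ G.Adj c a) ∨
    (¬ G.Adj s a ∧ ¬ G.Adj s' a ∧ ∃ c ∈ X, ∃ c' ∈ X, c ≠ c' ∧ G.Adj s c ∧ G.Adj c a ∧
      G.Adj s' c' ∧ G.Adj c' a))

/-- The sign of a vertex `a` of the side `X` with respect to the vertex `s` of the separator `S`:
`1` if `a` is a neighbour of `s`, `-1` if `a` is the end of two induced paths `s - c - a`, and `0`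
otherwise or if `a` is exceptional. -/
noncomputable def sign (G : SimpleGraph V) (S X : Finset V) (s a : V) : ℤ :=
  if G.IsExceptional S X a then 0 else
    if G.Adj s a then 1 else if 2 ≤ G.cherries X s a then -1 else 0

/-- An upper bound for the number of induced paths on four vertices that contain `a ∈ A` and `b ∈ B`
as the relevant pair on different sides of the separator `S`. -/
noncomputable def crossWeight (G : SimpleGraph V) (A B S : Finset V) (a b : V) : ℕ :=
  (∑ s ∈ S, if G.Adj s a then G.cherries B s b else 0) +
  (∑ s ∈ S, if G.Adj s b then G.cherries A s a else 0) +
  ((S ×ˢ S).filter fun p => p.1 ≠ p.2 ∧ G.Adj p.1 a ∧ G.Adj p.2 b).card +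
  ((S ×ˢ S).filter fun p => p.1 ≠ p.2 ∧
    ((G.Adj p.1 a ∧ G.Adj p.2 a) ∨ (G.Adj p.1 b ∧ G.Adj p.2 b))).card

theorem K23Free.cherries_le_two (hG : G.K23Free) {X : Finset V} {s d : V} (hsd : s ≠ d) :
    G.cherries X s d ≤ 2 :=
  hG.card_common_neighbors_le_two hsd fun c hc => by
    rw [Finset.mem_filter] at hc
    exact ⟨hc.2.1, hc.2.2.1.symm⟩

theorem cherries_eq_zero {X : Finset V} {s d : V} (h : G.Adj s d) : G.cherries X s d = 0 := by
  rw [cherries, Finset.card_eq_zero, Finset.filter_eq_empty_iff]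
  exact fun c _ hc => hc.2.2 h

/-- The vertices that are ends of two induced paths `s - c - d` are at most as many as the neighbours
of `s`: each is adjacent to two neighbours `c` of `s`, and each `c` is adjacent to at most two of
them, by `K23Free.card_path_le_two` for `c` and `s`. -/
theorem K23Free.card_two_cherries_le (hG : G.K23Free) {X : Finset V} {s : V} (hs : s ∉ X) :
    (X.filter fun d => 2 ≤ G.cherries X s d).card ≤ (X.filter fun c => G.Adj s c).card := by
  have h := Finset.card_mul_le_card_mul (m := 2) (n := 2) (fun d c => G.Adj c d ∧ ¬ G.Adj s d)
    (s := X.filter fun d => 2 ≤ G.cherries X s d) (t := X.filter fun c => G.Adj s c) ?_ ?_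
  · omega
  · intro d hd
    refine (Finset.mem_filter.1 hd).2.trans (Finset.card_le_card fun c hc => ?_)
    rw [Finset.mem_filter] at hc
    exact Finset.mem_filter.2 ⟨Finset.mem_filter.2 ⟨hc.1, hc.2.1⟩, hc.2.2⟩
  · intro c hc
    rw [Finset.mem_filter] at hc
    refine hG.card_path_le_two hc.2.symm fun d hd => ?_
    obtain ⟨hd, hcd, hsd⟩ := Finset.mem_filter.1 hd
    rw [Finset.mem_filter] at hd
    refine ⟨hcd, hsd, fun h => hs (h ▸ hd.1), ?_⟩
    obtain ⟨c', hc', hne⟩ := Finset.exists_mem_ne (lt_of_lt_of_le one_lt_two hd.2) c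
    rw [Finset.mem_filter] at hc'
    exact ⟨c', hne, hc'.2.2.1.symm, hc'.2.1⟩

/-- Each of the at most `25` pairs of vertices of `S` makes at most `2 + 4 + 32` vertices exceptional. -/
theorem K23Free.card_exceptional_le (hG : G.K23Free) {S X : Finset V} (hS : S.card ≤ 5)
    (hSX : Disjoint X S) : (X.filter fun a => G.IsExceptional S X a).card ≤ 950 := by
  let E : V × V → Finset V := fun p => if p.1 = p.2 then ∅ else
    (X.filter fun a => G.Adj p.1 a ∧ G.Adj p.2 a) ∪
    (X.filter fun a => G.Adj p.1 a ∧ ¬ G.Adj p.2 a ∧ ∃ c ∈ X, G.Adj p.2 c ∧ G.Adj c a) ∪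
    (X.filter fun a => ¬ G.Adj p.1 a ∧ ¬ G.Adj p.2 a ∧ ∃ c ∈ X, ∃ c' ∈ X, c ≠ c' ∧ G.Adj p.1 c ∧
      G.Adj c a ∧ G.Adj p.2 c' ∧ G.Adj c' a)
  have hsub : (X.filter fun a => G.IsExceptional S X a) ⊆ (S ×ˢ S).biUnion E := by
    intro a ha
    obtain ⟨haX, s, hs, s', hs', hne, h⟩ := Finset.mem_filter.1 ha
    refine Finset.mem_biUnion.2 ⟨(s, s'), Finset.mem_product.2 ⟨hs, hs'⟩, ?_⟩
    simp only [E, if_neg hne, Finset.mem_union, Finset.mem_filter, haX, true_and, or_assoc]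
    exact h
  have hXS : ∀ x ∈ X, ∀ s ∈ S, x ≠ s := fun x hx s hs h =>
    Finset.disjoint_left.1 hSX hx (h ▸ hs)
  have hE : ∀ p ∈ S ×ˢ S, (E p).card ≤ 38 := by
    rintro ⟨s, s'⟩ hp
    obtain ⟨hs, hs'⟩ := Finset.mem_product.1 hp
    simp only at hs hs'
    by_cases hne : s = s'
    · simp [E, hne]
    simp only [E, if_neg hne]
    refine (Finset.card_union_le _ _).trans ?_
    refine (Nat.add_le_add_right (Finset.card_union_le _ _) _).trans ?_
    have h1 : (X.filter fun a => G.Adj s a ∧ G.Adj s' a).card ≤ 2 :=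
      hG.card_common_neighbors_le_two hne fun a ha => (Finset.mem_filter.1 ha).2
    have h2 : (X.filter fun a => G.Adj s a ∧ ¬ G.Adj s' a ∧
        ∃ c ∈ X, G.Adj s' c ∧ G.Adj c a).card ≤ 4 :=
      hG.card_path_le_four hne fun a ha => by
        obtain ⟨haX, h1, h2, c, hc, h3, h4⟩ := Finset.mem_filter.1 ha
        exact ⟨h1, h2, hXS a haX s' hs', c, hXS c hc s hs, h4.symm, h3⟩
    have h3 : (X.filter fun a => ¬ G.Adj s a ∧ ¬ G.Adj s' a ∧ ∃ c ∈ X, ∃ c' ∈ X, c ≠ c' ∧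
        G.Adj s c ∧ G.Adj c a ∧ G.Adj s' c' ∧ G.Adj c' a).card ≤ 32 :=
      hG.card_two_paths_le hne fun a ha => by
        obtain ⟨haX, h1, h2, c, hc, c', hc', h3, h4⟩ := Finset.mem_filter.1 ha
        exact ⟨h1, h2, hXS a haX s hs, hXS a haX s' hs', c, c', h3, hXS c hc s' hs',
          hXS c' hc' s hs, h4⟩
    omega
  calc (X.filter fun a => G.IsExceptional S X a).card ≤ ((S ×ˢ S).biUnion E).card :=
        Finset.card_le_card hsub
    _ ≤ (S ×ˢ S).card * 38 := Finset.card_biUnion_le_card_mul _ _ _ hE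
    _ ≤ 950 := by
        rw [Finset.card_product]
        have := Nat.mul_le_mul hS hS
        omega

/-- Up to exceptional vertices, there are no more negative signs than positive ones. -/
theorem K23Free.sum_sign_ge (hG : G.K23Free) {S X : Finset V} (hS : S.card ≤ 5)
    (hSX : Disjoint X S) {s : V} (hs : s ∈ S) : -950 ≤ ∑ a ∈ X, G.sign S X s a := by
  have hle : ∀ a ∈ X, (if G.Adj s a then 1 else 0) - (if 2 ≤ G.cherries X s a then 1 else 0) -
      (if G.IsExceptional S X a then 1 else 0) ≤ G.sign S X s a := by
    intro a _
    rw [sign]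
    by_cases h : G.Adj s a
    · rw [cherries_eq_zero h]
      split_ifs <;> simp_all
    · split_ifs <;> simp_all
  have hsum := Finset.sum_le_sum hle
  rw [Finset.sum_sub_distrib, Finset.sum_sub_distrib, Finset.sum_boole, Finset.sum_boole,
    Finset.sum_boole] at hsum
  have h1 := hG.card_two_cherries_le (Finset.disjoint_right.1 hSX hs)
  have h2 := hG.card_exceptional_le hS hSX
  omega

theorem sum_sign_le (S X : Finset V) (s : V) : ∑ a ∈ X, G.sign S X s a ≤ X.card := by
  rw [Finset.cast_card]
  refine Finset.sum_le_sum fun a _ => ?_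
  rw [sign]
  split_ifs <;> simp

/-- The sums in `crossWeight` are at most `2 * 5` each, and the counts of pairs at most `25` each. -/
theorem K23Free.crossWeight_le_const (hG : G.K23Free) {A B S : Finset V} (hS : S.card ≤ 5)
    {a b : V} (ha : a ∉ S) (hb : b ∉ S) : G.crossWeight A B S a b ≤ 70 := by
  classical
  have hSS : (S ×ˢ S).card ≤ 25 := by
    rw [Finset.card_product]
    exact Nat.mul_le_mul hS hS
  have hsum : ∀ (X : Finset V) (x y : V), y ∉ S →
      (∑ s ∈ S, if G.Adj s x then G.cherries X s y else 0) ≤ 10 := fun X x y hy => by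
    refine (Finset.sum_le_card_nsmul S _ 2 fun s hs => ?_).trans ?_
    · split_ifs
      · exact hG.cherries_le_two fun h => hy (h ▸ hs)
      · simp
    · simp only [smul_eq_mul]
      omega
  rw [crossWeight]
  have h1 := hsum B a b hb
  have h2 := hsum A b a ha
  have h3 := Finset.card_filter_le (S ×ˢ S) fun p => p.1 ≠ p.2 ∧ G.Adj p.1 a ∧ G.Adj p.2 b
  have h4 := Finset.card_filter_le (S ×ˢ S) fun p => p.1 ≠ p.2 ∧
    ((G.Adj p.1 a ∧ G.Adj p.2 a) ∨ (G.Adj p.1 b ∧ G.Adj p.2 b))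
  omega

/-- If neither `a` nor `b` is exceptional, then at most one induced path is counted for this pair, up
to a correction by a sum of products of signs, whose total is almost nonnegative. -/
theorem K23Free.crossWeight_le_sign (hG : G.K23Free) {A B S : Finset V} {a b : V} (ha : a ∉ S)
    (hb : b ∉ S) (ha' : ¬ G.IsExceptional S A a) (hb' : ¬ G.IsExceptional S B b) :
    (G.crossWeight A B S a b : ℤ) ≤ 1 - ∑ s ∈ S, G.sign S A s a * G.sign S B s b := by
  classical
  have uniq : ∀ {X : Finset V} {x s : V}, ¬ G.IsExceptional S X x → s ∈ S → G.Adj s x →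
      ∀ s' ∈ S, s' ≠ s → ¬ G.Adj s' x ∧ G.cherries X s' x = 0 := by
    intro X x s hx hs hsx s' hs' hne
    have hs'x : ¬ G.Adj s' x := fun h => hx ⟨s, hs, s', hs', hne.symm, Or.inl ⟨hsx, h⟩⟩
    refine ⟨hs'x, ?_⟩
    rw [cherries, Finset.card_eq_zero, Finset.filter_eq_empty_iff]
    exact fun c hc h => hx ⟨s, hs, s', hs', hne.symm, Or.inr (Or.inl ⟨hsx, hs'x, c, hc, h.1, h.2.1⟩)⟩
  have fourth : (S ×ˢ S).filter (fun p => p.1 ≠ p.2 ∧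
      ((G.Adj p.1 a ∧ G.Adj p.2 a) ∨ (G.Adj p.1 b ∧ G.Adj p.2 b))) = ∅ := by
    rw [Finset.filter_eq_empty_iff]
    rintro ⟨s, s'⟩ hp ⟨hne, h⟩
    rw [Finset.mem_product] at hp
    rcases h with h | h
    · exact ha' ⟨s, hp.1, s', hp.2, hne, Or.inl h⟩
    · exact hb' ⟨s, hp.1, s', hp.2, hne, Or.inl h⟩
  -- The case in which `x` has a neighbour in `S` but `y` has none.
  have mixed : ∀ {X Y : Finset V} {x y s : V}, y ∉ S → ¬ G.IsExceptional S X x →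
      ¬ G.IsExceptional S Y y → s ∈ S → G.Adj s x → (∀ s ∈ S, ¬ G.Adj s y) →
      ((∑ s ∈ S, if G.Adj s x then G.cherries Y s y else 0 : ℕ) : ℤ) ≤
        1 - ∑ s ∈ S, G.sign S X s x * G.sign S Y s y := by
    intro X Y x y s hy hx hye hs hsx hny
    rw [Finset.sum_eq_single_of_mem s hs fun s' hs' hne => if_neg (uniq hx hs hsx s' hs' hne).1,
      if_pos hsx, Finset.sum_eq_single_of_mem s hs fun s' hs' hne => ?_]
    · have h2 := hG.cherries_le_two (X := Y) (s := s) (d := y) fun h => hy (h ▸ hs)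
      rw [sign, sign, if_neg hx, if_neg hye, if_pos hsx, if_neg (hny s hs)]
      split_ifs <;> omega
    · obtain ⟨h1, h2⟩ := uniq hx hs hsx s' hs' hne
      rw [sign, if_neg hx, if_neg h1, h2]
      simp
  have none_sum : ∀ {X : Finset V} {x y : V}, (∀ s ∈ S, ¬ G.Adj s x) →
      (∑ s ∈ S, if G.Adj s x then G.cherries X s y else 0) = 0 := fun h =>
    Finset.sum_eq_zero fun s hs => if_neg (h s hs)
  have third : (∀ s ∈ S, ¬ G.Adj s a) ∨ (∀ s ∈ S, ¬ G.Adj s b) →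
      (S ×ˢ S).filter (fun p => p.1 ≠ p.2 ∧ G.Adj p.1 a ∧ G.Adj p.2 b) = ∅ := by
    intro h
    rw [Finset.filter_eq_empty_iff]
    rintro ⟨s, s'⟩ hp ⟨-, h1, h2⟩
    rw [Finset.mem_product] at hp
    rcases h with h | h
    exacts [h s hp.1 h1, h s' hp.2 h2]
  rw [crossWeight, fourth, Finset.card_empty, add_zero]
  by_cases h1 : ∃ s ∈ S, G.Adj s a <;> by_cases h2 : ∃ s ∈ S, G.Adj s b
  · obtain ⟨s, hs, hsa⟩ := h1
    obtain ⟨t, ht, htb⟩ := h2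
    have e1 : (∑ s ∈ S, if G.Adj s a then G.cherries B s b else 0) = 0 :=
      Finset.sum_eq_zero fun r hr => by
        by_cases hrt : r = t
        · simp [hrt, cherries_eq_zero htb]
        · simp [(uniq hb' ht htb r hr hrt).2]
    have e2 : (∑ s ∈ S, if G.Adj s b then G.cherries A s a else 0) = 0 :=
      Finset.sum_eq_zero fun r hr => by
        by_cases hrs : r = s
        · simp [hrs, cherries_eq_zero hsa]
        · simp [(uniq ha' hs hsa r hr hrs).2]
    have e3 : ∑ r ∈ S, G.sign S A r a * G.sign S B r b = if s = t then 1 else 0 := by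
      rw [Finset.sum_eq_single_of_mem s hs fun r hr hrs => ?_]
      · rw [sign, if_neg ha', if_pos hsa, one_mul, sign, if_neg hb']
        split_ifs with h3 h4 h5 h6
        · rfl
        · by_contra
          exact (uniq hb' ht htb s hs h4).1 h3
        · exact absurd (h6 ▸ htb) h3
        · have := (uniq hb' ht htb s hs h6).2
          omega
        · exact absurd (by rename_i h; exact h ▸ htb) h3
        · rfl
      · obtain ⟨h1, h2⟩ := uniq ha' hs hsa r hr hrs
        rw [sign, if_neg ha', if_neg h1, h2]
        simp
    have e4 : (S ×ˢ S).filter (fun p => p.1 ≠ p.2 ∧ G.Adj p.1 a ∧ G.Adj p.2 b) ⊆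
        if s = t then ∅ else {(s, t)} := by
      rintro ⟨r, r'⟩ hp
      simp only [Finset.mem_filter, Finset.mem_product] at hp
      obtain ⟨⟨hr, hr'⟩, hne, h1, h2⟩ := hp
      have h3 : r = s := by
        by_contra h
        exact (uniq ha' hs hsa r hr h).1 h1
      have h4 : r' = t := by
        by_contra h
        exact (uniq hb' ht htb r' hr' h).1 h2
      subst h3 h4
      simp [hne]
    have := Finset.card_le_card e4
    rw [e1, e2, e3]
    split_ifs at this ⊢ <;> simp at this ⊢ <;> omega
  · push Not at h2
    obtain ⟨s, hs, hsa⟩ := h1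
    rw [none_sum h2, third (Or.inr h2), Finset.card_empty, add_zero, add_zero]
    exact mixed hb ha' hb' hs hsa h2
  · push Not at h1
    obtain ⟨s, hs, hsb⟩ := h2
    rw [none_sum h1, third (Or.inl h1), Finset.card_empty, add_zero, zero_add]
    simp only [mul_comm (G.sign S A _ a)]
    exact mixed ha hb' ha' hs hsb h1
  · push Not at h1 h2
    rw [none_sum h1, none_sum h2, third (Or.inl h1)]
    have hsgn : ∀ s ∈ S, G.sign S A s a * G.sign S B s b ≤ if 2 ≤ G.cherries A s a then 1 else 0 := by
      intro s hs
      rw [sign, sign, if_neg ha', if_neg hb', if_neg (h1 s hs), if_neg (h2 s hs)]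
      split_ifs <;> simp
    have hone : (S.filter fun s => 2 ≤ G.cherries A s a).card ≤ 1 := by
      rw [Finset.card_le_one]
      intro s hs s' hs'
      by_contra hne
      rw [Finset.mem_filter] at hs hs'
      obtain ⟨c, hc⟩ : (A.filter fun c => G.Adj s c ∧ G.Adj c a ∧ ¬ G.Adj s a).Nonempty :=
        Finset.card_pos.1 (lt_of_lt_of_le two_pos hs.2)
      obtain ⟨c', hc', hcc'⟩ := Finset.exists_mem_ne (lt_of_lt_of_le one_lt_two hs'.2) c
      rw [Finset.mem_filter] at hc hc'
      exact ha' ⟨s, hs.1, s', hs'.1, hne, Or.inr (Or.inr ⟨h1 s hs.1, h1 s' hs'.1, c, hc.1, c',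
        hc'.1, hcc'.symm, hc.2.1, hc.2.2.1, hc'.2.1, hc'.2.2.1⟩)⟩
    have hsum := Finset.sum_le_sum hsgn
    rw [Finset.sum_boole] at hsum
    have : ((S.filter fun s => 2 ≤ G.cherries A s a).card : ℤ) ≤ 1 := by exact_mod_cast hone
    simp only [Finset.card_empty, add_zero, Nat.cast_zero]
    linarith

/-- The vertex set `T` induces a path on four vertices. -/
def IsP4Set (G : SimpleGraph V) (T : Finset V) : Prop :=
  ∃ a b c d, G.IsInducedP4 a b c d ∧ T = {a, b, c, d}

/-- The number of vertex sets inside `W` that induce a path on four vertices. -/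
noncomputable def p4Count (G : SimpleGraph V) (W : Finset V) : ℕ :=
  (W.powerset.filter G.IsP4Set).card

theorem quadruple_reverse (a b c d : V) : ({a, b, c, d} : Finset V) = {d, c, b, a} := by
  ext v
  simp only [Finset.mem_insert, Finset.mem_singleton]
  tauto

theorem IsP4Set.card_eq {T : Finset V} (h : G.IsP4Set T) : T.card = 4 := by
  obtain ⟨a, b, c, d, ⟨h1, h2, h3, h4, h5, h6, h7, h8⟩, rfl⟩ := h
  have had : a ≠ d := fun h => h5 (h ▸ h1.symm)
  rw [Finset.card_eq_succ]
  refine ⟨a, {b, c, d}, ?_, rfl, Finset.card_eq_three.2 ⟨b, c, d, h2.ne, h8, h3.ne, rfl⟩⟩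
  simp [h1.ne, h7, had]

/-- The ways in which an induced path with vertex set `T` passes from `a ∈ A` to `b ∈ B` through the
separator `S`. -/
def Crosses (G : SimpleGraph V) (A B S : Finset V) (a b : V) (T : Finset V) : Prop :=
  (∃ s ∈ S, ∃ c ∈ B, G.Adj s a ∧ G.Adj s c ∧ G.Adj c b ∧ ¬ G.Adj s b ∧ T = {a, s, c, b}) ∨
  (∃ s ∈ S, ∃ c ∈ A, G.Adj s b ∧ G.Adj s c ∧ G.Adj c a ∧ ¬ G.Adj s a ∧ T = {b, s, c, a}) ∨
  (∃ s ∈ S, ∃ s' ∈ S, s ≠ s' ∧ G.Adj s a ∧ G.Adj s' b ∧ T = {a, s, s', b}) ∨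
  (∃ s ∈ S, ∃ s' ∈ S, s ≠ s' ∧ ((G.Adj s a ∧ G.Adj s' a) ∨ (G.Adj s b ∧ G.Adj s' b)) ∧
    T = {a, b, s, s'})

theorem card_crosses_le (A B S : Finset V) (a b : V) (U : Finset (Finset V)) :
    (U.filter fun T => G.Crosses A B S a b T).card ≤ G.crossWeight A B S a b := by
  have hF : ∀ (X : Finset V) (x y : V),
      (S.biUnion fun s => if G.Adj s x then
        (X.filter fun c => G.Adj s c ∧ G.Adj c y ∧ ¬ G.Adj s y).image
          fun c => ({x, s, c, y} : Finset V) else ∅).card ≤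
      ∑ s ∈ S, if G.Adj s x then G.cherries X s y else 0 := by
    intro X x y
    refine Finset.card_biUnion_le.trans (Finset.sum_le_sum fun s _ => ?_)
    split_ifs
    · exact Finset.card_image_le
    · simp
  rw [crossWeight]
  refine le_trans (Finset.card_le_card ?_) ((Finset.card_union_le _ _).trans (Nat.add_le_add
    ((Finset.card_union_le _ _).trans (Nat.add_le_add ((Finset.card_union_le _ _).trans
    (Nat.add_le_add (hF B a b) (hF A b a))) (Finset.card_image_le
      (f := fun p : V × V => ({a, p.1, p.2, b} : Finset V))))) (Finset.card_image_le
      (f := fun p : V × V => ({a, b, p.1, p.2} : Finset V)))))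
  intro T hT
  rcases (Finset.mem_filter.1 hT).2 with ⟨s, hs, c, hc, h, h1, h2, h3, rfl⟩ |
    ⟨s, hs, c, hc, h, h1, h2, h3, rfl⟩ | ⟨s, hs, s', hs', hne, h1, h2, rfl⟩ |
    ⟨s, hs, s', hs', hne, h, rfl⟩
  · refine Finset.mem_union_left _ (Finset.mem_union_left _ (Finset.mem_union_left _
      (Finset.mem_biUnion.2 ⟨s, hs, ?_⟩)))
    rw [if_pos h]
    exact Finset.mem_image_of_mem _ (Finset.mem_filter.2 ⟨hc, h1, h2, h3⟩)
  · refine Finset.mem_union_left _ (Finset.mem_union_left _ (Finset.mem_union_right _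
      (Finset.mem_biUnion.2 ⟨s, hs, ?_⟩)))
    rw [if_pos h]
    exact Finset.mem_image_of_mem _ (Finset.mem_filter.2 ⟨hc, h1, h2, h3⟩)
  · exact Finset.mem_union_left _ (Finset.mem_union_right _ (Finset.mem_image.2
      ⟨(s, s'), Finset.mem_filter.2 ⟨Finset.mem_product.2 ⟨hs, hs'⟩, hne, h1, h2⟩, rfl⟩))
  · exact Finset.mem_union_right _ (Finset.mem_image.2
      ⟨(s, s'), Finset.mem_filter.2 ⟨Finset.mem_product.2 ⟨hs, hs'⟩, hne, h⟩, rfl⟩)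

/-- An induced path that meets both sides of a separation and whose second vertex is in the
separator; reversing a path gives the case of the third vertex. -/
theorem IsInducedP4.exists_crosses {A B S : Finset V} (hAB : Disjoint A B) (hAS : Disjoint A S)
    (hBS : Disjoint B S) (hadj : ∀ a ∈ A, ∀ b ∈ B, ¬ G.Adj a b) {v₁ v₂ v₃ v₄ : V}
    (h : G.IsInducedP4 v₁ v₂ v₃ v₄) (m2 : v₂ ∈ S) (m3 : v₃ ∈ A ∪ B ∪ S)
    (m4 : v₄ ∈ A ∪ B ∪ S) (hA : ∃ a ∈ A, a ∈ ({v₁, v₂, v₃, v₄} : Finset V))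
    (hB : ∃ b ∈ B, b ∈ ({v₁, v₂, v₃, v₄} : Finset V)) :
    ∃ a ∈ A, ∃ b ∈ B, G.Crosses A B S a b {v₁, v₂, v₃, v₄} := by
  obtain ⟨h12, h23, h34, h13, h24, h14, n13, n24⟩ := h
  obtain ⟨x, hxA, hx⟩ := hA
  obtain ⟨y, hyB, hy⟩ := hB
  simp only [Finset.mem_insert, Finset.mem_singleton] at hx hy
  have dAB : ∀ v ∈ A, v ∉ B := fun v hv => Finset.disjoint_left.1 hAB hv
  have dAS : ∀ v ∈ A, v ∉ S := fun v hv => Finset.disjoint_left.1 hAS hv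
  have dBS : ∀ v ∈ B, v ∉ S := fun v hv => Finset.disjoint_left.1 hBS hv
  have hadj' : ∀ b ∈ B, ∀ a ∈ A, ¬ G.Adj b a := fun b hb a ha h => hadj a ha b hb h.symm
  simp only [Finset.mem_union, or_assoc] at m3 m4
  rcases m3 with m3 | m3 | m3
  · have m4' : v₄ ∈ A ∨ v₄ ∈ S := by
      rcases m4 with h | h | h
      exacts [Or.inl h, absurd h34 (hadj _ m3 _ h), Or.inr h]
    have m1' : v₁ ∈ B := by
      rcases hy with rfl | rfl | rfl | rfl
      · exact hyB
      · exact absurd m2 (dBS _ hyB)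
      · exact absurd hyB (dAB _ m3)
      · rcases m4' with h | h
        exacts [absurd hyB (dAB _ h), absurd h (dBS _ hyB)]
    rcases m4' with m4' | m4'
    · exact ⟨v₄, m4', v₁, m1', Or.inr (Or.inl ⟨v₂, m2, v₃, m3, h12.symm, h23, h34, h24, rfl⟩)⟩
    · refine ⟨v₃, m3, v₁, m1', Or.inr (Or.inr (Or.inr ⟨v₂, m2, v₄, m4', n24,
        Or.inl ⟨h23, h34.symm⟩, ?_⟩))⟩
      rw [Finset.insert_comm v₃ v₁, Finset.insert_comm v₃ v₂]
  · have m4' : v₄ ∈ B ∨ v₄ ∈ S := by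
      rcases m4 with h | h | h
      exacts [absurd h34 (hadj' _ m3 _ h), Or.inl h, Or.inr h]
    have m1' : v₁ ∈ A := by
      rcases hx with rfl | rfl | rfl | rfl
      · exact hxA
      · exact absurd m2 (dAS _ hxA)
      · exact absurd m3 (dAB _ hxA)
      · rcases m4' with h | h
        exacts [absurd h (dAB _ hxA), absurd h (dAS _ hxA)]
    rcases m4' with m4' | m4'
    · exact ⟨v₁, m1', v₄, m4', Or.inl ⟨v₂, m2, v₃, m3, h12.symm, h23, h34, h24, rfl⟩⟩
    · refine ⟨v₁, m1', v₃, m3, Or.inr (Or.inr (Or.inr ⟨v₂, m2, v₄, m4', n24,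
        Or.inr ⟨h23, h34.symm⟩, ?_⟩))⟩
      rw [Finset.insert_comm v₃ v₂]
  · have hx' : x = v₁ ∨ x = v₄ := by
      rcases hx with h | h | h | h
      exacts [Or.inl h, absurd (h ▸ m2) (dAS _ hxA), absurd (h ▸ m3) (dAS _ hxA), Or.inr h]
    have hy' : y = v₁ ∨ y = v₄ := by
      rcases hy with h | h | h | h
      exacts [Or.inl h, absurd (h ▸ m2) (dBS _ hyB), absurd (h ▸ m3) (dBS _ hyB), Or.inr h]
    refine ⟨x, hxA, y, hyB, Or.inr (Or.inr (Or.inl ?_))⟩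
    rcases hx' with rfl | rfl <;> rcases hy' with rfl | rfl
    · exact absurd hyB (dAB _ hxA)
    · exact ⟨v₂, m2, v₃, m3, h23.ne, h12.symm, h34, rfl⟩
    · exact ⟨v₃, m3, v₂, m2, h23.ne', h34, h12.symm, quadruple_reverse _ _ _ _⟩
    · exact absurd hyB (dAB _ hxA)

/-- The induced paths on four vertices inside `A ∪ B ∪ S`, where `S` separates `A` from `B`, lie
on one side or are counted by the weights of pairs. -/
theorem p4Count_union_le {A B S : Finset V} (hAB : Disjoint A B) (hAS : Disjoint A S)
    (hBS : Disjoint B S) (hadj : ∀ a ∈ A, ∀ b ∈ B, ¬ G.Adj a b) :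
    G.p4Count (A ∪ B ∪ S) ≤ G.p4Count (A ∪ S) + G.p4Count (B ∪ S) +
      ∑ a ∈ A, ∑ b ∈ B, G.crossWeight A B S a b := by
  classical
  let U := (A ∪ B ∪ S).powerset
  have hsub : U.filter G.IsP4Set ⊆
      ((A ∪ S).powerset.filter G.IsP4Set ∪ (B ∪ S).powerset.filter G.IsP4Set) ∪
        A.biUnion fun a => B.biUnion fun b => U.filter fun T => G.Crosses A B S a b T := by
    intro T hT
    obtain ⟨hTU, hP4⟩ := Finset.mem_filter.1 hT
    have hTW := Finset.mem_powerset.1 hTU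
    by_cases hA : ∃ a ∈ A, a ∈ T
    · by_cases hB : ∃ b ∈ B, b ∈ T
      · refine Finset.mem_union_right _ ?_
        simp only [Finset.mem_biUnion, Finset.mem_filter, hTU, true_and]
        obtain ⟨v₁, v₂, v₃, v₄, h, rfl⟩ := hP4
        have m1 : v₁ ∈ A ∪ B ∪ S := hTW (by simp)
        have m2 : v₂ ∈ A ∪ B ∪ S := hTW (by simp)
        have m3 : v₃ ∈ A ∪ B ∪ S := hTW (by simp)
        have m4 : v₄ ∈ A ∪ B ∪ S := hTW (by simp)
        by_cases h2 : v₂ ∈ S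
        · exact h.exists_crosses hAB hAS hBS hadj h2 m3 m4 hA hB
        by_cases h3 : v₃ ∈ S
        · rw [quadruple_reverse] at hA hB ⊢
          exact h.reverse.exists_crosses hAB hAS hBS hadj h3 m2 m1 hA hB
        -- If neither inner vertex is in `S`, then the path does not change sides.
        exfalso
        obtain ⟨x, hxA, hx⟩ := hA
        obtain ⟨y, hyB, hy⟩ := hB
        obtain ⟨h12, h23, h34, -⟩ := h
        have hadj' : ∀ b ∈ B, ∀ a ∈ A, ¬ G.Adj b a := fun b hb a ha h => hadj a ha b hb h.symm
        have dAB : ∀ v ∈ A, v ∉ B := fun v hv => Finset.disjoint_left.1 hAB hv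
        simp only [Finset.mem_insert, Finset.mem_singleton] at hx hy
        simp only [Finset.mem_union, h2, h3, or_false] at m2 m3
        rcases m2 with m2 | m2 <;> rcases m3 with m3 | m3
        · rcases hy with rfl | rfl | rfl | rfl
          exacts [hadj' _ hyB _ m2 h12, dAB _ m2 hyB, dAB _ m3 hyB, hadj _ m3 _ hyB h34]
        · exact hadj _ m2 _ m3 h23
        · exact hadj' _ m2 _ m3 h23
        · rcases hx with rfl | rfl | rfl | rfl
          exacts [hadj _ hxA _ m2 h12, dAB _ hxA m2, dAB _ hxA m3, hadj' _ m3 _ hxA h34]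
      · refine Finset.mem_union_left _ (Finset.mem_union_left _ (Finset.mem_filter.2 ⟨?_, hP4⟩))
        refine Finset.mem_powerset.2 fun v hv => ?_
        have := hTW hv
        simp only [Finset.mem_union] at this ⊢
        have : v ∉ B := fun h => hB ⟨v, h, hv⟩
        tauto
    · refine Finset.mem_union_left _ (Finset.mem_union_right _ (Finset.mem_filter.2 ⟨?_, hP4⟩))
      refine Finset.mem_powerset.2 fun v hv => ?_
      have := hTW hv
      simp only [Finset.mem_union] at this ⊢
      have : v ∉ A := fun h => hA ⟨v, h, hv⟩
      tauto
  refine (Finset.card_le_card hsub).trans ((Finset.card_union_le _ _).trans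
    (Nat.add_le_add (Finset.card_union_le _ _) ?_))
  refine Finset.card_biUnion_le.trans (Finset.sum_le_sum fun a _ => ?_)
  exact Finset.card_biUnion_le.trans (Finset.sum_le_sum fun b _ => card_crosses_le A B S a b U)

/-- Up to a linear error, a separation contributes at most one crossing induced path for each pair
of vertices on different sides. The sum of the products of signs factors, for each vertex of `S`,
into two sums that are at least `-950`; the pairs with an exceptional vertex contribute at most
`950 * 70 * (|A| + |B|)`. -/
theorem K23Free.sum_crossWeight_le (hG : G.K23Free) {A B S : Finset V} (hS : S.card ≤ 5)
    (hAS : Disjoint A S) (hBS : Disjoint B S) :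
    ((∑ a ∈ A, ∑ b ∈ B, G.crossWeight A B S a b : ℕ) : ℤ) ≤
      A.card * B.card + 71250 * (A.card + B.card) + 4512500 := by
  classical
  have hpt : ∀ a ∈ A, ∀ b ∈ B, (G.crossWeight A B S a b : ℤ) ≤
      1 - ∑ s ∈ S, G.sign S A s a * G.sign S B s b +
        ((if G.IsExceptional S A a then 70 else 0) + if G.IsExceptional S B b then 70 else 0) := by
    intro a ha b hb
    have haS := Finset.disjoint_left.1 hAS ha
    have hbS := Finset.disjoint_left.1 hBS hb
    have h70 : (G.crossWeight A B S a b : ℤ) ≤ 70 := by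
      exact_mod_cast hG.crossWeight_le_const hS haS hbS
    by_cases hea : G.IsExceptional S A a
    · have h0 : ∑ s ∈ S, G.sign S A s a * G.sign S B s b = 0 :=
        Finset.sum_eq_zero fun s _ => by simp [sign, hea]
      rw [h0, if_pos hea]
      split_ifs <;> omega
    by_cases heb : G.IsExceptional S B b
    · have h0 : ∑ s ∈ S, G.sign S A s a * G.sign S B s b = 0 :=
        Finset.sum_eq_zero fun s _ => by simp [sign, heb]
      rw [h0, if_neg hea, if_pos heb]
      omega
    rw [if_neg hea, if_neg heb]
    simpa using hG.crossWeight_le_sign haS hbS hea heb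
  have hsum := Finset.sum_le_sum fun a ha => Finset.sum_le_sum (hpt a ha)
  have hswap : ∑ a ∈ A, ∑ b ∈ B, ∑ s ∈ S, G.sign S A s a * G.sign S B s b =
      ∑ s ∈ S, (∑ a ∈ A, G.sign S A s a) * ∑ b ∈ B, G.sign S B s b := by
    simp only [Finset.sum_mul_sum]
    rw [Finset.sum_comm (s := S)]
    exact Finset.sum_congr rfl fun a _ => Finset.sum_comm
  simp only [Finset.sum_add_distrib, Finset.sum_sub_distrib, hswap, Finset.sum_const,
    ← Finset.sum_filter, nsmul_eq_mul, ← Finset.mul_sum] at hsum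
  have hEA := hG.card_exceptional_le hS hAS
  have hEB := hG.card_exceptional_le hS hBS
  have hprod : ∀ s ∈ S, -(950 * (A.card + B.card) + 902500 : ℤ) ≤
      (∑ a ∈ A, G.sign S A s a) * ∑ b ∈ B, G.sign S B s b := by
    intro s hs
    have h1 := hG.sum_sign_ge hS hAS hs
    have h2 := hG.sum_sign_ge hS hBS hs
    have h3 := G.sum_sign_le S A s
    have h4 := G.sum_sign_le S B s
    -- Expand `0 ≤ (x + 950) * (y + 950)` for the two sums `x ≤ |A|` and `y ≤ |B|`.
    nlinarith [mul_nonneg (by linarith : (0:ℤ) ≤ (∑ a ∈ A, G.sign S A s a) + 950)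
      (by linarith : (0:ℤ) ≤ (∑ b ∈ B, G.sign S B s b) + 950)]
  have hprods := Finset.card_nsmul_le_sum S _ _ hprod
  have hEA' : (B.card : ℤ) * ((A.filter fun a => G.IsExceptional S A a).card * 70) ≤
      B.card * (950 * 70) := by
    gcongr
    exact_mod_cast hEA
  have hEB' : (A.card : ℤ) * ((B.filter fun b => G.IsExceptional S B b).card * 70) ≤
      A.card * (950 * 70) := by
    gcongr
    exact_mod_cast hEB
  have hS' : (S.card : ℤ) * (950 * (A.card + B.card) + 902500) ≤
      5 * (950 * (A.card + B.card) + 902500) := by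
    gcongr
    exact_mod_cast hS
  rw [nsmul_eq_mul, mul_neg] at hprods
  push_cast
  linarith

end Crossing

end SimpleGraph

/-! ### The upper bound -/

namespace SimpleGraph

section UpperBound

open Classical

variable {V : Type*} {G : SimpleGraph V}

theorem K23Free.p4Count_union_le (hG : G.K23Free) {A B S : Finset V} (hAB : Disjoint A B)
    (hAS : Disjoint A S) (hBS : Disjoint B S) (hS : S.card ≤ 5)
    (hadj : ∀ a ∈ A, ∀ b ∈ B, ¬ G.Adj a b) :
    (G.p4Count (A ∪ B ∪ S) : ℝ) ≤ G.p4Count (A ∪ S) + G.p4Count (B ∪ S) + A.card * B.card +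
      71250 * (A.card + B.card) + 4512500 := by
  have h1 := SimpleGraph.p4Count_union_le hAB hAS hBS hadj
  have h2 := hG.sum_crossWeight_le (A := A) (B := B) hS hAS hBS
  have h3 : (G.p4Count (A ∪ B ∪ S) : ℤ) ≤ G.p4Count (A ∪ S) + G.p4Count (B ∪ S) + A.card * B.card +
      71250 * (A.card + B.card) + 4512500 := by
    zify at h1 h2
    linarith
  exact_mod_cast h3

theorem p4Count_le_choose (W : Finset V) : G.p4Count W ≤ W.card.choose 4 := by
  rw [← Finset.card_powersetCard]
  refine Finset.card_le_card fun T hT => ?_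
  rw [Finset.mem_filter, Finset.mem_powerset] at hT
  exact Finset.mem_powersetCard.2 ⟨hT.1, hT.2.card_eq⟩

/-- The bound for small sets, for which the constant absorbs the quartic trivial bound. -/
theorem p4Count_le_of_card_le {W : Finset V} (hW : W.card ≤ 6400) :
    (G.p4Count W : ℝ) ≤ (W.card : ℝ) ^ 2 / 2 + 10 ^ 12 * W.card * Real.log W.card := by
  have hle := G.p4Count_le_choose W
  rcases lt_or_ge W.card 4 with h | h
  · rw [Nat.choose_eq_zero_of_lt h, Nat.le_zero] at hle
    rw [hle]
    have := Real.log_natCast_nonneg W.card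
    push_cast
    positivity
  · have hlog : 1 ≤ Real.log W.card := by
      rw [Real.le_log_iff_exp_le (by positivity)]
      have : (4 : ℝ) ≤ W.card := by exact_mod_cast h
      linarith [Real.exp_one_lt_d9]
    have hpow : (G.p4Count W : ℝ) ≤ (W.card : ℝ) ^ 4 := by
      exact_mod_cast hle.trans (Nat.choose_le_pow _ _)
    have hcube : (W.card : ℝ) ^ 4 ≤ (10 : ℝ) ^ 12 * W.card := by
      have h1 : (W.card : ℝ) ≤ 6400 := by exact_mod_cast hW
      have h2 : (W.card : ℝ) ^ 3 ≤ 6400 ^ 3 := by gcongr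
      rw [pow_succ]
      exact mul_le_mul_of_nonneg_right (h2.trans (by norm_num)) (by positivity)
    have : (10 : ℝ) ^ 12 * W.card ≤ 10 ^ 12 * W.card * Real.log W.card :=
      le_mul_of_one_le_right (by positivity) hlog
    nlinarith [sq_nonneg (W.card : ℝ)]

theorem log_le_div_forty {x : ℝ} (hx : 6400 ≤ x) : Real.log x ≤ x / 40 := by
  -- Apply `log y ≤ y - 1` to `y = √x`, and `√x ≤ x / 80`.
  have h80 : 80 ≤ Real.sqrt x := Real.le_sqrt_of_sq_le (by norm_num; exact hx)
  have hsq := Real.mul_self_sqrt (by linarith : (0 : ℝ) ≤ x)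
  have h1 := Real.log_le_sub_one_of_pos (by linarith : 0 < Real.sqrt x)
  rw [Real.log_sqrt (by linarith)] at h1
  nlinarith

theorem mul_log_le_of_le {x n : ℝ} (hx : 0 ≤ x) (hxn : x ≤ 3 / 4 * n) :
    x * Real.log x ≤ x * (Real.log n - 1 / 4) := by
  rcases hx.eq_or_lt with rfl | hx0
  · simp
  have hn : 0 < n := by linarith
  refine mul_le_mul_of_nonneg_left ?_ hx
  have h1 : Real.log x ≤ Real.log (3 / 4 * n) := Real.log_le_log hx0 hxn
  rw [Real.log_mul (by norm_num) hn.ne'] at h1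
  have h2 := Real.log_le_sub_one_of_pos (by norm_num : (0 : ℝ) < 3 / 4)
  linarith

/-- Recursion along balanced separations: the pairs of vertices on different sides make up the
quadratic term, and the linear errors on the logarithmically many levels the error term. -/
theorem K23Free.p4Count_le (hG : G.K23Free) (W : Finset V) :
    (G.p4Count W : ℝ) ≤ (W.card : ℝ) ^ 2 / 2 + 10 ^ 12 * W.card * Real.log W.card := by
  induction hn : W.card using Nat.strong_induction_on generalizing W with
  | _ n ih =>
  subst hn
  rcases le_or_gt W.card 6400 with hW | hW
  · exact p4Count_le_of_card_le hW
  obtain ⟨A, B, S, hABS, hAB, hAS, hBS, hS, hA, hB, hadj⟩ :=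
    hG.exists_balanced_separation W (by omega)
  have hrec := hG.p4Count_union_le hAB hAS hBS hS hadj
  rw [hABS] at hrec
  have cAS : (A ∪ S).card = A.card + S.card := Finset.card_union_of_disjoint hAS
  have cBS : (B ∪ S).card = B.card + S.card := Finset.card_union_of_disjoint hBS
  have cW : A.card + B.card + S.card = W.card := by
    rw [← hABS, Finset.card_union_of_disjoint (Finset.disjoint_union_left.2 ⟨hAS, hBS⟩),
      Finset.card_union_of_disjoint hAB]
  have ihA := ih (A ∪ S).card (by omega) (A ∪ S) rfl
  have ihB := ih (B ∪ S).card (by omega) (B ∪ S) rfl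
  rw [cAS] at ihA
  rw [cBS] at ihB
  push_cast at ihA ihB
  have hA' : 3 * (A.card : ℝ) ≤ 2 * W.card := by exact_mod_cast hA
  have hB' : 3 * (B.card : ℝ) ≤ 2 * W.card := by exact_mod_cast hB
  have hS' : (S.card : ℝ) ≤ 5 := by exact_mod_cast hS
  have hW' : (6400 : ℝ) ≤ W.card := by exact_mod_cast hW.le
  have cW' : (A.card + B.card + S.card : ℝ) = W.card := by exact_mod_cast cW
  have hlog := log_le_div_forty hW'
  have hlog0 : 1 ≤ Real.log W.card := by
    rw [Real.le_log_iff_exp_le (by linarith)]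
    linarith [Real.exp_one_lt_d9]
  have lA := mul_log_le_of_le (x := A.card + S.card) (n := W.card) (by positivity) (by linarith)
  have lB := mul_log_le_of_le (x := B.card + S.card) (n := W.card) (by positivity) (by linarith)
  generalize (A.card : ℝ) = a at *
  generalize (B.card : ℝ) = b at *
  have hs0 : (0 : ℝ) ≤ S.card := by positivity
  generalize (S.card : ℝ) = s at *
  generalize (W.card : ℝ) = w at *
  generalize Real.log w = l at *
  -- Both parts have at most `3 / 4` of the vertices, which lowers the error term by `10 ^ 12 * w / 4`;
  -- this pays for the additional `5 * l` and for the linear error of the separation.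
  have h1 : (a + s) * Real.log (a + s) + (b + s) * Real.log (b + s) ≤ w * l + 5 * l - w / 4 := by
    have : (a + s) * (l - 1 / 4) + (b + s) * (l - 1 / 4) = (w + s) * (l - 1 / 4) := by
      rw [← cW']; ring
    nlinarith
  have h2 : (a + s) ^ 2 / 2 + (b + s) ^ 2 / 2 + a * b = w ^ 2 / 2 + s ^ 2 / 2 := by
    rw [← cW']; ring
  nlinarith

end UpperBound

/-! ### Induced copies of the path on four vertices -/

section Count

open Classical

variable {V : Type*} {G : SimpleGraph V}

theorem nonempty_iso_pathGraph_iff (S : Finset V) :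
    Nonempty (G.induce (S : Set V) ≃g pathGraph 4) ↔ G.IsP4Set S := by
  constructor
  · rintro ⟨φ⟩
    have hadj : ∀ i j : Fin 4, G.Adj (φ.symm i) (φ.symm j) ↔ (pathGraph 4).Adj i j := fun i j => by
      rw [← φ.symm.map_adj_iff]
      rfl
    have hinj : ∀ i j : Fin 4, i ≠ j → (φ.symm i : V) ≠ φ.symm j := fun i j hij h =>
      hij (φ.symm.injective (Subtype.ext h))
    refine ⟨φ.symm 0, φ.symm 1, φ.symm 2, φ.symm 3, ?_, ?_⟩
    · simp only [IsInducedP4, hadj, pathGraph_adj]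
      exact ⟨by decide, by decide, by decide, by decide, by decide, by decide,
        hinj _ _ (by decide), hinj _ _ (by decide)⟩
    · ext v
      simp only [Finset.mem_insert, Finset.mem_singleton]
      constructor
      · intro hv
        have : (φ.symm (φ ⟨v, hv⟩) : V) = v := by simp
        generalize φ ⟨v, hv⟩ = i at this
        fin_cases i
        exacts [Or.inl this.symm, Or.inr (Or.inl this.symm), Or.inr (Or.inr (Or.inl this.symm)),
          Or.inr (Or.inr (Or.inr this.symm))]
      · rintro (rfl | rfl | rfl | rfl) <;> exact Subtype.coe_prop (φ.symm _)
  · rintro ⟨a, b, c, d, ⟨h1, h2, h3, h4, h5, h6, h7, h8⟩, rfl⟩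
    have had : a ≠ d := fun h => h5 (h ▸ h1.symm)
    let f : Fin 4 → ((({a, b, c, d} : Finset V) : Set V)) := ![⟨a, by simp⟩, ⟨b, by simp⟩,
      ⟨c, by simp⟩, ⟨d, by simp⟩]
    have hinj : Function.Injective f := by
      intro i j hij
      have := congrArg Subtype.val hij
      fin_cases i <;> fin_cases j <;> simp [f, h1.ne, h1.ne', h2.ne, h2.ne', h3.ne, h3.ne', h7,
        h7.symm, h8, h8.symm, had, had.symm] at this ⊢
    have hsurj : Function.Surjective f := by
      rintro ⟨v, hv⟩
      simp only [Finset.coe_insert, Finset.coe_singleton, Set.mem_insert_iff,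
        Set.mem_singleton_iff] at hv
      rcases hv with rfl | rfl | rfl | rfl
      exacts [⟨0, rfl⟩, ⟨1, rfl⟩, ⟨2, rfl⟩, ⟨3, rfl⟩]
    have hadj : ∀ i j, G.Adj (f i) (f j) ↔ (pathGraph 4).Adj i j := by
      intro i j
      rw [pathGraph_adj]
      fin_cases i <;> fin_cases j <;> simp [f, h1, h1.symm, h2, h2.symm, h3, h3.symm, h4, h5, h6,
        G.adj_comm c a, G.adj_comm d b, G.adj_comm d a]
    exact ⟨RelIso.symm ⟨Equiv.ofBijective f ⟨hinj, hsurj⟩, fun {i j} => hadj i j⟩⟩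

theorem inducedCopyCount_eq_p4Count [Fintype V] :
    G.inducedCopyCount (pathGraph 4) = G.p4Count Finset.univ := by
  classical
  rw [inducedCopyCount, p4Count, ← Set.ncard_coe_finset]
  congr 1
  ext S
  simp only [nonempty_iso_pathGraph_iff, Set.mem_ofPred_eq, Finset.coe_filter, Finset.mem_powerset,
    Finset.subset_univ, true_and]

end Count

end SimpleGraph

/-! ### Drawings on a parabola -/

/-- A point of the chord of the parabola over `a` and `b` lies above the parabola by
`(x - a) * (b - x)`. -/
theorem chord_parabola {a b : ℝ} {z : ℝ × ℝ} (hz : z ∈ segment ℝ (a, a ^ 2) (b, b ^ 2)) :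
    z.2 - z.1 ^ 2 = (z.1 - a) * (b - z.1) ∧ 0 ≤ (z.1 - a) * (b - z.1) := by
  obtain ⟨s, t, hs, ht, hst, rfl⟩ := hz
  obtain rfl : s = 1 - t := by linarith
  simp only [Prod.smul_mk, Prod.mk_add_mk, smul_eq_mul]
  refine ⟨by ring, ?_⟩
  have : ((1 - t) * a + t * b - a) * (b - ((1 - t) * a + t * b)) =
      ((1 - t) * t) * (b - a) ^ 2 := by ring
  rw [this]
  positivity

/-- Two chords of the parabola that neither cross nor coincide meet at most in end points. -/
theorem chords_parabola_inter {a b c d x : ℝ} (hab : a < b) (hcd : c < d)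
    (h₁ : ¬ (a < c ∧ c < b ∧ b < d)) (h₂ : ¬ (c < a ∧ a < d ∧ d < b)) (hne : ¬ (a = c ∧ b = d))
    (hx : (x - a) * (b - x) = (x - c) * (d - x)) (h0 : 0 ≤ (x - a) * (b - x)) :
    x = a ∨ x = b := by
  by_contra! hcon
  have hpos : 0 < (x - a) * (b - x) :=
    h0.lt_of_ne (mul_ne_zero (sub_ne_zero.2 hcon.1) (sub_ne_zero.2 hcon.2.symm)).symm
  have inside : ∀ {p q : ℝ}, p < q → 0 < (x - p) * (q - x) → p < x ∧ x < q := by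
    intro p q hpq h
    rcases mul_pos_iff.1 h with h | h <;> constructor <;> linarith
  obtain ⟨hax, hxb⟩ := inside hab hpos
  obtain ⟨hcx, hxd⟩ := inside hcd (hx ▸ hpos)
  rcases lt_trichotomy a c with h | h | h
  · have hdb : d ≤ b := not_lt.1 fun hbd => h₁ ⟨h, by linarith, hbd⟩
    nlinarith
  · subst h
    have := mul_left_cancel₀ (sub_pos.2 hax).ne' hx
    exact hne ⟨rfl, by linarith⟩
  · have hbd : b ≤ d := not_lt.1 fun hdb => h₂ ⟨h, by linarith, hdb⟩
    nlinarith

namespace SimpleGraph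

/-- A graph on `0, …, n - 1` without crossing edges is outerplanar: put vertex `i` at the point
`(i, i ^ 2)` and draw the edges as chords. The region below the parabola lies in the outer face. -/
theorem isOuterplanar_of_noncrossing {n : ℕ} {G : SimpleGraph (Fin n)}
    (h : ∀ a b c d : Fin n, a < b → b < c → c < d → G.Adj a c → G.Adj b d → False) :
    G.IsOuterplanar := by
  let pt : Fin n → ℝ × ℝ := fun i => ((i : ℝ), (i : ℝ) ^ 2)
  let arc : Sym2 (Fin n) → Set (ℝ × ℝ) := fun e => convexHull ℝ (pt '' {v | v ∈ e})
  have harc : ∀ a b, arc s(a, b) = segment ℝ (pt a) (pt b) := fun a b => by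
    have : {v | v ∈ s(a, b)} = {a, b} := by
      ext v
      simp
    simp only [arc]
    rw [this, Set.image_pair, convexHull_pair]
  have hinj : Function.Injective pt := fun a b hab => by
    have : (a : ℝ) = b := congrArg Prod.fst hab
    exact Fin.ext (by exact_mod_cast this)
  have hlt : ∀ {a b : Fin n}, (a : ℝ) < b ↔ a < b := fun {a b} => by
    rw [Nat.cast_lt, Fin.val_fin_lt]
  -- Two edges, with the ends of each in increasing order, meet in vertices.
  have hinter : ∀ a b c d : Fin n, a < b → c < d → G.Adj a b → G.Adj c d → s(a, b) ≠ s(c, d) →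
      arc s(a, b) ∩ arc s(c, d) ⊆ Set.range pt := by
    rintro a b c d hab hcd hGab hGcd hne z ⟨hz, hz'⟩
    rw [harc] at hz hz'
    obtain ⟨e1, p1⟩ := chord_parabola hz
    obtain ⟨e2, -⟩ := chord_parabola hz'
    have := chords_parabola_inter (hlt.2 hab) (hlt.2 hcd)
      (fun hc => h a c b d (hlt.1 hc.1) (hlt.1 hc.2.1) (hlt.1 hc.2.2) hGab hGcd)
      (fun hc => h c a d b (hlt.1 hc.1) (hlt.1 hc.2.1) (hlt.1 hc.2.2) hGcd hGab)
      (fun hc => hne (by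
        rw [Fin.ext (by exact_mod_cast hc.1 : (a : ℕ) = c),
          Fin.ext (by exact_mod_cast hc.2 : (b : ℕ) = d)])) (e1.symm.trans e2) p1
    rcases this with hx | hx
    · refine ⟨a, Prod.ext hx.symm ?_⟩
      rw [hx, sub_self, zero_mul] at e1
      simp only [pt]
      linarith
    · refine ⟨b, Prod.ext hx.symm ?_⟩
      rw [hx, sub_self, mul_zero] at e1
      simp only [pt]
      linarith
  have hsort : ∀ e ∈ G.edgeSet, ∃ a b, a < b ∧ G.Adj a b ∧ e = s(a, b) := by
    intro e
    induction e with
    | _ a b =>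
    intro hab
    rw [mem_edgeSet] at hab
    rcases lt_or_gt_of_ne hab.ne with hlt | hlt
    · exact ⟨a, b, hlt, hab, rfl⟩
    · exact ⟨b, a, hlt, hab.symm, Sym2.eq_swap⟩
  let D : G.PlaneDrawing :=
    { point := pt
      arc := fun e => arc e
      point_injective := hinj
      arc_isSimpleArc := by
        intro u v huv
        let γ : _root_.Path (pt u) (pt v) :=
          { toFun := fun t => AffineMap.lineMap (pt u) (pt v) (t : ℝ)
            continuous_toFun := by fun_prop
            source' := by simp
            target' := by simp }
        refine ⟨γ, fun s t hst => ?_, ?_⟩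
        · exact Subtype.ext (AffineMap.lineMap_injective ℝ (hinj.ne huv.ne) hst)
        · rw [harc, segment_eq_image_lineMap]
          ext z
          constructor
          · rintro ⟨t, ht, rfl⟩
            exact ⟨⟨t, ht⟩, rfl⟩
          · rintro ⟨t, rfl⟩
            exact ⟨t, t.2, rfl⟩
      mem_of_point_mem_arc := by
        rintro ⟨e, he⟩ w hw
        obtain ⟨a, b, -, -, rfl⟩ := hsort e he
        simp only [harc] at hw
        obtain ⟨e1, -⟩ := chord_parabola hw
        have e1' : ((w : ℝ) - a) * (b - w) = 0 := by
          rw [← e1]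
          simp [pt]
        rcases mul_eq_zero.1 e1' with h | h
        · exact Sym2.mem_iff.2 (Or.inl (Fin.ext (by exact_mod_cast sub_eq_zero.1 h)))
        · exact Sym2.mem_iff.2 (Or.inr (Fin.ext (by exact_mod_cast (sub_eq_zero.1 h).symm)))
      arc_inter_arc := by
        rintro ⟨e, he⟩ ⟨f, hf⟩ hne
        obtain ⟨a, b, hab, hGab, rfl⟩ := hsort e he
        obtain ⟨c, d, hcd, hGcd, rfl⟩ := hsort f hf
        exact hinter a b c d hab hcd hGab hGcd fun h => hne (Subtype.ext h) }
  let L : Set (ℝ × ℝ) := {z | z.2 < z.1 ^ 2}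
  have hLD : L ⊆ D.carrierᶜ := by
    rintro z hz (⟨i, rfl⟩ | hzD)
    · have hz' : (i : ℝ) ^ 2 < (i : ℝ) ^ 2 := hz
      exact lt_irrefl _ hz'
    · obtain ⟨⟨e, he⟩, hze⟩ := Set.mem_iUnion.1 hzD
      obtain ⟨a, b, -, -, rfl⟩ := hsort e he
      have hze' : z ∈ arc s(a, b) := hze
      rw [harc] at hze'
      obtain ⟨e1, p1⟩ := chord_parabola hze'
      have hz' : z.2 < z.1 ^ 2 := hz
      linarith
  have hLc : IsPreconnected L := by
    have hL : L = (fun p : ℝ × ℝ => (p.1, p.1 ^ 2 + p.2)) '' (Set.univ ×ˢ Set.Iio 0) := by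
      ext z
      constructor
      · intro hz
        have hz' : z.2 < z.1 ^ 2 := hz
        exact ⟨(z.1, z.2 - z.1 ^ 2), ⟨trivial, by simpa using hz'⟩, by simp⟩
      · rintro ⟨p, ⟨-, hp⟩, rfl⟩
        have hp' : p.2 < 0 := hp
        simp only [L, Set.mem_ofPred_eq]
        linarith
    rw [hL]
    exact (isPreconnected_univ.prod isPreconnected_Iio).image _ (by fun_prop)
  have hLunb : ¬ Bornology.IsBounded L := by
    intro hb
    obtain ⟨r, hr⟩ := hb.exists_norm_le
    have hmem : ((0 : ℝ), -(|r| + 1)) ∈ L := by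
      simp only [L, Set.mem_ofPred_eq]
      have := abs_nonneg r
      linarith
    have h1 := (norm_snd_le _).trans (hr _ hmem)
    have h2 : |r| + 1 ≤ |(-(|r| + 1))| := by
      rw [abs_neg]
      exact le_abs_self _
    simp only [Real.norm_eq_abs] at h1
    linarith [le_abs_self r]
  have hLface : L ⊆ D.outerFace := fun z hz =>
    ⟨hLD hz, fun hb => hLunb (hb.subset (hLc.subset_connectedComponentIn hz hLD))⟩
  refine ⟨D, fun v => closure_mono hLface ?_⟩
  rw [Metric.mem_closure_iff]
  intro ε hε
  refine ⟨((v : ℝ), (v : ℝ) ^ 2 - ε / 2), ?_, ?_⟩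
  · simp only [L, Set.mem_ofPred_eq]
    linarith
  · change Dist.dist (((v : ℝ), (v : ℝ) ^ 2) : ℝ × ℝ) _ < ε
    rw [Prod.dist_eq, _root_.dist_self, Real.dist_eq, sub_sub_cancel, abs_of_pos (by linarith)]
    exact max_lt hε (by linarith)

/-! ### An asymptotically extremal graph -/

/-- The edges `ij`, `i < j`, of the extremal graph: vertex `0` is joined to all odd vertices, the
others form a path `1, 2, 3, …`, and so do the odd vertices. Thus `0` is the hub of a fan over the
path of odd vertices, and the even vertices form triangles with the edges of this path. -/
def FanEdge (i j : ℕ) : Prop :=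
  (i = 0 ∧ j % 2 = 1) ∨ (1 ≤ i ∧ j = i + 1) ∨ (i % 2 = 1 ∧ j = i + 2)

/-- The fan over a path with a triangle attached to each edge of the path, on `n` vertices. -/
def fanGraph (n : ℕ) : SimpleGraph (Fin n) where
  Adj i j := FanEdge i j ∨ FanEdge j i
  symm := ⟨fun _ _ h => h.symm⟩
  loopless := ⟨fun i h => by
    simp only [FanEdge, or_self] at h
    omega⟩

theorem isOuterplanar_fanGraph (n : ℕ) : (fanGraph n).IsOuterplanar := by
  refine isOuterplanar_of_noncrossing fun a b c d hab hbc hcd hac hbd => ?_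
  simp only [fanGraph, FanEdge, Fin.lt_def] at *
  omega

section LowerBound

open Classical

/-- An even vertex `2 * i`, one of its two odd neighbours `2 * (i + e) - 1`, the hub `0`, and any odd
vertex away from `2 * i` form an induced path. The odd vertices away from `2 * i` are numbered by
`r` through a gap of length four. -/
theorem le_p4Count_fanGraph (n : ℕ) :
    (n / 2 - 1) * (2 * (n / 2 - 4)) ≤ (fanGraph n).p4Count Finset.univ := by
  let k : ℕ → ℕ → ℕ := fun i r => if r + 2 < i then r else r + 4
  let f : ℕ × ℕ × ℕ → Finset (Fin n) := fun p => Finset.univ.filter fun v =>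
    (v : ℕ) = 2 * p.1 ∨ (v : ℕ) = 2 * (p.1 + p.2.1) - 1 ∨ (v : ℕ) = 0 ∨
      (v : ℕ) = 2 * k p.1 p.2.2 + 1
  have hk : ∀ i r, (k i r + 2 < i ∨ i + 1 < k i r) ∧ k i r ≤ r + 4 := fun i r => by
    simp only [k]
    split_ifs <;> omega
  have hkinj : ∀ i r r', k i r = k i r' → r = r' := fun i r r' h => by
    simp only [k] at h
    split_ifs at h <;> omega
  have hcard : (Finset.Ico 1 (n / 2) ×ˢ Finset.range 2 ×ˢ Finset.range (n / 2 - 4)).card =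
      (n / 2 - 1) * (2 * (n / 2 - 4)) := by
    simp
  rw [← hcard, p4Count]
  refine Finset.card_le_card_of_injOn f ?_ ?_
  · rintro ⟨i, e, r⟩ hp
    simp only [Finset.coe_product, Set.mem_prod, Finset.mem_coe, Finset.mem_Ico,
      Finset.mem_range] at hp
    obtain ⟨hk1, hk2⟩ := hk i r
    simp only [Finset.coe_filter, Finset.powerset_univ, Finset.mem_univ, true_and,
      Set.mem_ofPred_eq]
    refine ⟨⟨2 * i, by omega⟩, ⟨2 * (i + e) - 1, by omega⟩, ⟨0, by omega⟩,
      ⟨2 * k i r + 1, by omega⟩, ?_, ?_⟩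
    · simp only [IsInducedP4, fanGraph, FanEdge, ne_eq, Fin.mk.injEq, true_and]
      refine ⟨?_, ?_, ?_, ?_, ?_, ?_, ?_, ?_⟩ <;> omega
    · ext v
      simp only [f, Finset.mem_filter, Finset.mem_univ, true_and, Finset.mem_insert,
        Finset.mem_singleton, Fin.ext_iff]
  · rintro ⟨i, e, r⟩ hp ⟨i', e', r'⟩ hp' heq
    simp only [Finset.coe_product, Set.mem_prod, Finset.mem_coe, Finset.mem_Ico,
      Finset.mem_range] at hp hp'
    obtain ⟨hk1, hk2⟩ := hk i r
    obtain ⟨hk1', hk2'⟩ := hk i' r'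
    have hmem : ∀ m : ℕ, m < n → ((m = 2 * i ∨ m = 2 * (i + e) - 1 ∨ m = 0 ∨ m = 2 * k i r + 1) ↔
        (m = 2 * i' ∨ m = 2 * (i' + e') - 1 ∨ m = 0 ∨ m = 2 * k i' r' + 1)) := fun m hm => by
      have := Finset.ext_iff.1 heq ⟨m, hm⟩
      simpa only [f, Finset.mem_filter, Finset.mem_univ, true_and] using this
    have m1 := hmem (2 * i) (by omega)
    have m2 := hmem (2 * (i + e) - 1) (by omega)
    have m3 := hmem (2 * k i r + 1) (by omega)
    obtain rfl : i = i' := by omega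
    obtain rfl : e = e' := by omega
    obtain rfl : r = r' := hkinj i r r' (by omega)
    rfl

end LowerBound

end SimpleGraph

open SimpleGraph in
theorem inducedCopyCount_pathGraph_le {n : ℕ} {G : SimpleGraph (Fin n)} (hG : G.IsOuterplanar) :
    (G.inducedCopyCount (pathGraph 4) : ℝ) ≤
      (n : ℝ) ^ 2 / 2 + 10 ^ 12 * (n : ℝ) * Real.log (n : ℝ) := by
  have h := hG.k23Free.p4Count_le Finset.univ
  rwa [← inducedCopyCount_eq_p4Count, Finset.card_univ, Fintype.card_fin] at h

theorem theorem2 :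
    (∃ C : ℝ, ∀ (n : ℕ) (G : SimpleGraph (Fin n)), G.IsOuterplanar →
      (G.inducedCopyCount (SimpleGraph.pathGraph 4) : ℝ) ≤
        (n : ℝ) ^ 2 / 2 + C * (n : ℝ) * Real.log (n : ℝ)) ∧
    (∃ G : (n : ℕ) → SimpleGraph (Fin n), (∀ n : ℕ, (G n).IsOuterplanar) ∧
      (fun n : ℕ => ((G n).inducedCopyCount (SimpleGraph.pathGraph 4) : ℝ)) ~[atTop]
        (fun n : ℕ => (n : ℝ) ^ 2 / 2)) := by
  refine ⟨⟨10 ^ 12, fun n G hG => inducedCopyCount_pathGraph_le hG⟩, SimpleGraph.fanGraph,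
    SimpleGraph.isOuterplanar_fanGraph, ?_⟩
  have hO : (fun n : ℕ => ((SimpleGraph.fanGraph n).inducedCopyCount (SimpleGraph.pathGraph 4) : ℝ) -
      (n : ℝ) ^ 2 / 2) =O[atTop] fun n : ℕ => (n : ℝ) * Real.log n := by
    refine IsBigO.of_bound (10 ^ 12) ?_
    filter_upwards [eventually_ge_atTop 20] with n hn
    have hn' : (20 : ℝ) ≤ n := by exact_mod_cast hn
    have hlog : 1 ≤ Real.log n := by
      rw [Real.le_log_iff_exp_le (by linarith)]
      linarith [Real.exp_one_lt_d9]
    have hupper := inducedCopyCount_pathGraph_le (SimpleGraph.isOuterplanar_fanGraph n)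
    have hlower : ((n : ℝ) - 3) * (n - 9) / 2 ≤
        (SimpleGraph.fanGraph n).inducedCopyCount (SimpleGraph.pathGraph 4) := by
      rw [SimpleGraph.inducedCopyCount_eq_p4Count]
      have h := SimpleGraph.le_p4Count_fanGraph n
      have h1 : ((n : ℝ) - 3) / 2 ≤ ((n / 2 - 1 : ℕ) : ℝ) := by
        have : n ≤ 2 * (n / 2 - 1) + 3 := by omega
        have : (n : ℝ) ≤ 2 * ((n / 2 - 1 : ℕ) : ℝ) + 3 := by exact_mod_cast this
        linarith
      have h2 : ((n : ℝ) - 9) / 2 ≤ ((n / 2 - 4 : ℕ) : ℝ) := by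
        have : n ≤ 2 * (n / 2 - 4) + 9 := by omega
        have : (n : ℝ) ≤ 2 * ((n / 2 - 4 : ℕ) : ℝ) + 9 := by exact_mod_cast this
        linarith
      have h3 : (((n / 2 - 1) * (2 * (n / 2 - 4)) : ℕ) : ℝ) ≤
          (SimpleGraph.fanGraph n).p4Count Finset.univ := by exact_mod_cast h
      rw [Nat.cast_mul, Nat.cast_mul] at h3
      have h4 := mul_le_mul h1 h2 (by linarith) (Nat.cast_nonneg _)
      push_cast at h3
      linarith
    rw [Real.norm_eq_abs, Real.norm_eq_abs, abs_of_nonneg (a := (n : ℝ) * Real.log n) (by positivity)]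
    have hnlog : (n : ℝ) ≤ n * Real.log n := le_mul_of_one_le_right (by linarith) hlog
    rw [abs_le]
    constructor <;> nlinarith
  refine hO.trans_isLittleO ?_
  have hlog : (fun n : ℕ => Real.log (n : ℝ)) =o[atTop] fun n : ℕ => (n : ℝ) :=
    Real.isLittleO_log_id_atTop.comp_tendsto tendsto_natCast_atTop_atTop
  refine ((isBigO_refl (fun n : ℕ => (n : ℝ)) atTop).mul_isLittleO hlog).trans_isBigO ?_
  refine IsBigO.of_bound 2 (Eventually.of_forall fun n => ?_)
  rw [Real.norm_of_nonneg (by positivity), Real.norm_of_nonneg (by positivity)]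
  apply le_of_eq
  ring
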